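/- **Conventions.** For a lattice $M$ (free abelian group) of rank $n$ put $N=\mathrm{Hom}(M,\mathbf Z)$ and $M_{\mathbf Q}=M\otimes\mathbf Q$, $N_{\mathbf Q}=N\otimes\mathbf Q=\mathrm{Hom}(M_{\mathbf Q},\mathbf Q)$. If $\Delta\subset M_{\mathbf Q}$ is the convex hull of finitely many points of $M$ and contains $0$ in its interior, then $(\Delta,M)$ is called a *reflexive pair* of dimension $n$ if every affine hyperplane spanned by an $(n-1)$-dimensional face of $\Delta$ has integral distance $1$ to $0$, i.e. is of the form $\{x\mid\langle x,l\rangle=c\}$ with $l\in N$ primitive, $c\in\mathbf Z$ and $|c|=1$. A *finite morphism* $\phi:(\Delta_1,M_1)\to(\Delta_2,M_2)$ of reflexive pairs of the same dimension is a homomorphism $\phi:M_1\to M_2$ with $\phi(\Delta_1)=\Delta_2$. A finite morphism $\phi^0:(\Delta,M)\to(\Delta^0,M^0)$ is *maximal* if for every finite morphism $\psi:(\Delta,M)\to(\Delta',M')$ there is a unique finite morphism $\phi:(\Delta',M')\to(\Delta^0,M^0)$ with $\phi^0=\phi\circ\psi$; a reflexive pair is *maximal* if its identity morphism is maximal. The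 toric variety of $(\Delta,M)$ is $\mathbf P_{\Delta,M}=\mathrm{Proj}\,S_\Delta$, where $S_\Delta$ is the $\mathbf C$-algebra with basis the monomials $X_0^{m_0}X^m$, $(m_0,m)\in\mathbf Z\oplus M$, with $(m_0,m)=0$ or $m_0>0$ and $m/m_0\in\Delta$, graded by $m_0$. For positive integers $w_0,\dots,w_n$, $\mathbf P(w_0,\dots,w_n)=\mathrm{Proj}\,\mathbf C[x_0,\dots,x_n]$ with $\deg x_i=w_i$. **Theorem.** Let $(\Delta,M)$ be a reflexive pair of dimension $n$ such that $\Delta$ is a simplex with vertices $p_0,\dots,p_n\in M$. There are unique positive integers $w_0,\dots,w_n$ (the *weights* of $\Delta$) with $\gcd(w_0,\dots,w_n)=1$ and $\sum_i w_ip_i=0$, and there are unique $l_0,\dots,l_n\in N$ that are the vertices of the dual simplex $\Delta^*=\{y\in N_{\mathbf Q}\mid\langle x,y\rangle\ge-1\text{ for all }x\in\Delta\}$, labelled so that $\langle p_i,l_j\rangle=-1$ for $i\ne j$. Put $$M(w)=\Big\{x\in\mathbf Z^{n+1}\ \Big|\ \sum_{i=0}^n w_ix_i=0\Big\},\qquad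 \iota_\Delta:M\to M(w),\quad \iota_\Delta(m)=(\langle m,l_0\rangle,\dots,\langle m,l_n\rangle)$$ (the image of $m\mapsto(\langle m,l_j\rangle)_j$ does lie in $M(w)$), and let $\Delta(w)\subset M(w)_{\mathbf Q}$ be the convex hull of the points $\iota_\Delta(p_0),\dots,\iota_\Delta(p_n)$. Then $(\Delta(w),M(w))$ is a reflexive pair of dimension $n$, and 1. its toric Fano variety $\mathbf P_{\Delta(w),M(w)}$ is isomorphic, over $\mathbf C$, to the weighted projective space $\mathbf P(w_0,\dots,w_n)$; 2. $\iota_\Delta:(\Delta,M)\to(\Delta(w),M(w))$ is a finite morphism of reflexive pairs; 3. $(\Delta(w),M(w))$ is a maximal reflexive pair. -/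

import Mathlib

open scoped TensorProduct

universe u v

noncomputable section

namespace ReflexiveSimplex

/-! ### Lattices and their rational extensions -/

section Lattice

variable {M : Type u} [AddCommGroup M]

/-- The rational extension `M_ℚ` of an abelian group `M`. -/
abbrev RatExt (M : Type u) [AddCommGroup M] : Type u := ℚ ⊗[ℤ] M

/-- The canonical map `M → M_ℚ`, `m ↦ 1 ⊗ m`. -/
def toRat : M →ₗ[ℤ] RatExt M := TensorProduct.mk ℤ ℚ M 1

/-- The inclusion of the dual lattice `N = Hom(M, ℤ)` into `N_ℚ`, where `N_ℚ` is
realised as the dual space of `M_ℚ`. -/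
def dualToRat (l : Module.Dual ℤ M) : Module.Dual ℚ (RatExt M) :=
  LinearMap.liftBaseChange ℚ (Algebra.linearMap ℤ ℚ ∘ₗ l)

lemma dualToRat_toRat (l : Module.Dual ℤ M) (m : M) :
    dualToRat l (toRat m) = (l m : ℚ) := by
  change LinearMap.liftBaseChange ℚ (Algebra.linearMap ℤ ℚ ∘ₗ l) ((1 : ℚ) ⊗ₜ[ℤ] m) = _
  rw [LinearMap.liftBaseChange_tmul]
  simp

/-- A primitive element of a lattice: it is not a proper integral multiple of an element. -/
def IsPrimitive {N : Type u} [AddCommGroup N] (l : N) : Prop :=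
  ∀ (k : ℤ) (l' : N), l = k • l' → IsUnit k

/-- The integral distance between the affine hyperplane `H` of `M_ℚ` and the lattice point `p`
is defined and equal to `d`: `H = {x | ⟨x, l⟩ = c}` with `l ∈ N` primitive and `c ∈ ℤ`, and
`|c - ⟨p, l⟩| = d`. -/
def HasIntegralDistance (H : Set (RatExt M)) (p : M) (d : ℤ) : Prop :=
  ∃ (l : Module.Dual ℤ M) (c : ℤ), IsPrimitive l ∧
    H = {x | dualToRat l x = (c : ℚ)} ∧ |c - l p| = d

end Lattice

/-! ### Convex polyhedra -/

section Polyhedra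

variable {V : Type u} [AddCommGroup V] [Module ℚ V]

/-- Interior points of a convex set in a finite-dimensional rational vector space: one can move
a little in each direction. -/
def IsInteriorPoint (P : Set V) (x : V) : Prop :=
  ∀ v : V, ∃ ε : ℚ, 0 < ε ∧ ∀ t : ℚ, 0 ≤ t → t ≤ ε → x + t • v ∈ P

/-- `Θ` is a nonempty face of `P`: the set of points where a linear function that is bounded
below by `c` on `P` attains the value `c`. -/
def IsFace (P Θ : Set V) : Prop :=
  Θ.Nonempty ∧ ∃ (y : Module.Dual ℚ V) (c : ℚ), (∀ x ∈ P, c ≤ y x) ∧ Θ = {x ∈ P | y x = c}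

/-- `P` is a simplex with vertices `v 0, …, v n`. -/
def IsSimplex {n : ℕ} (P : Set V) (v : Fin (n + 1) → V) : Prop :=
  AffineIndependent ℚ v ∧ P = convexHull ℚ (Set.range v)

/-- The dual set `P^* = {y | ⟨x, y⟩ ≥ -1 for all x ∈ P}`. -/
def dualSet (P : Set V) : Set (Module.Dual ℚ V) := {y | ∀ x ∈ P, -1 ≤ y x}

end Polyhedra

/-! ### Reflexive pairs and their morphisms -/

section ReflexivePairs

/-- `(Δ, M)` is a reflexive pair of dimension `n`. -/
structure IsReflexivePair {M : Type u} [AddCommGroup M] (n : ℕ) (Δ : Set (RatExt M)) : Prop where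
  /-- `M` is a lattice of rank `n` -/
  free : Module.Free ℤ M
  finite : Module.Finite ℤ M
  rank_eq : Module.finrank ℤ M = n
  /-- `Δ` is a convex polyhedron with integral vertices -/
  integral : ∃ S : Finset M, Δ = convexHull ℚ (toRat '' (S : Set M))
  /-- `Δ` contains `0` in its interior -/
  zero_interior : IsInteriorPoint Δ 0
  /-- the hyperplanes generated by the `(n - 1)`-dimensional faces have integral distance `1`
  to `0` -/
  distance : ∀ Θ : Set (RatExt M), IsFace Δ Θ →
    Module.finrank ℚ (vectorSpan ℚ Θ) + 1 = n →
    HasIntegralDistance (affineSpan ℚ Θ : Set (RatExt M)) 0 1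

/-- `φ : (Δ₁, M₁) → (Δ₂, M₂)` is a finite morphism of reflexive pairs of dimension `n`. -/
structure IsFiniteMorphism {M₁ : Type u} [AddCommGroup M₁] {M₂ : Type v} [AddCommGroup M₂]
    (n : ℕ) (Δ₁ : Set (RatExt M₁)) (Δ₂ : Set (RatExt M₂)) (φ : M₁ →ₗ[ℤ] M₂) : Prop where
  source : IsReflexivePair n Δ₁
  target : IsReflexivePair n Δ₂
  image_eq : φ.baseChange ℚ '' Δ₁ = Δ₂

universe u₀ u₁ u₂

/-- The finite morphism `φ₀ : (Δ, M) → (Δ₀, M₀)` is maximal: every finite morphism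
`ψ : (Δ, M) → (Δ', M')` has a unique morphism `φ : (Δ', M') → (Δ₀, M₀)` with `φ₀ = φ ∘ ψ`. -/
def IsMaximalMorphism {M : Type u₁} [AddCommGroup M] {M₀ : Type u₀} [AddCommGroup M₀]
    (n : ℕ) (Δ : Set (RatExt M)) (Δ₀ : Set (RatExt M₀)) (φ₀ : M →ₗ[ℤ] M₀) : Prop :=
  IsFiniteMorphism n Δ Δ₀ φ₀ ∧
    ∀ (M' : Type u₂) [AddCommGroup M'] (Δ' : Set (RatExt M')) (ψ : M →ₗ[ℤ] M'),
      IsFiniteMorphism n Δ Δ' ψ →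
        ∃! φ : M' →ₗ[ℤ] M₀, IsFiniteMorphism n Δ' Δ₀ φ ∧ φ₀ = φ ∘ₗ ψ

/-- `(Δ, M)` is a maximal reflexive pair: its identity morphism is maximal (tested against
lattices in the universe `u₂`). -/
def IsMaximalReflexivePair {M : Type u₁} [AddCommGroup M] (n : ℕ) (Δ : Set (RatExt M)) : Prop :=
  IsMaximalMorphism.{u₁, u₁, u₂} n Δ Δ LinearMap.id

end ReflexivePairs

/-! ### Toric varieties of polyhedra and weighted projective spaces -/

section Toric

open AlgebraicGeometry CategoryTheory

variable {M : Type} [AddCommGroup M]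

/-- The lattice points `(m₀, m)` of the cone
`C_Δ = 0 ∪ {(x₀, x) | x₀ > 0, x / x₀ ∈ Δ}` supporting the convex set `Δ`. -/
def coneMonoid (Δ : Set (RatExt M)) (hΔ : Convex ℚ Δ) : AddSubmonoid (ℕ × M) where
  carrier := {a | a = 0 ∨ 0 < a.1 ∧ (a.1 : ℚ)⁻¹ • toRat a.2 ∈ Δ}
  zero_mem' := Or.inl rfl
  add_mem' := by
    rintro a b (rfl | ⟨ha, ha'⟩) hb
    · simpa using hb
    rcases hb with rfl | ⟨hb, hb'⟩
    · right; simpa using ⟨ha, ha'⟩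
    right
    refine ⟨Nat.add_pos_left ha _, ?_⟩
    have ha0 : (0 : ℚ) < a.1 := by exact_mod_cast ha
    have hb0 : (0 : ℚ) < b.1 := by exact_mod_cast hb
    have key := hΔ ha' hb' (a := (a.1 : ℚ) / (a.1 + b.1)) (b := (b.1 : ℚ) / (a.1 + b.1))
      (by positivity) (by positivity) (by field_simp)
    convert key using 1
    rw [Prod.fst_add, Prod.snd_add, map_add, smul_add, smul_smul, smul_smul]
    push_cast
    congr 2 <;> field_simp

/-- The degree `(m₀, m) ↦ m₀`. -/
def coneDegree (Δ : Set (RatExt M)) (hΔ : Convex ℚ Δ) : coneMonoid Δ hΔ →+ ℕ :=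
  (AddMonoidHom.fst ℕ M).comp (coneMonoid Δ hΔ).subtype

/-- The ring `S_Δ` with `ℂ`-basis the monomials `X₀^m₀ X^m`, `(m₀, m) ∈ C_Δ`. -/
abbrev polytopeRing (Δ : Set (RatExt M)) (hΔ : Convex ℚ Δ) : Type :=
  AddMonoidAlgebra ℂ (coneMonoid Δ hΔ)

/-- The grading of `S_Δ` by the exponent of `X₀`. -/
abbrev polytopeGrading (Δ : Set (RatExt M)) (hΔ : Convex ℚ Δ) :
    ℕ → Submodule ℂ (polytopeRing Δ hΔ) :=
  AddMonoidAlgebra.gradeBy ℂ (coneDegree Δ hΔ)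

/-- The `ℂ`-scheme `Proj 𝒜` of a graded `ℂ`-algebra. -/
def projOver {A : Type} [CommRing A] [Algebra ℂ A] (𝒜 : ℕ → Submodule ℂ A) [GradedAlgebra 𝒜] :
    Over (Spec (CommRingCat.of ℂ)) :=
  Over.mk (Proj.toSpecZero 𝒜 ≫ Spec.map (CommRingCat.ofHom (algebraMap ℂ (𝒜 0))))

/-- The toric variety `P_{Δ, M} = Proj S_Δ` as a scheme over `ℂ`. -/
def toricVariety (Δ : Set (RatExt M)) (hΔ : Convex ℚ Δ) : Over (Spec (CommRingCat.of ℂ)) :=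
  projOver (polytopeGrading Δ hΔ)

/-- The weighted projective space `P(w₀, …, w_n) = Proj ℂ[x₀, …, x_n]`, `deg x_i = w_i`,
as a scheme over `ℂ`. -/
def weightedProjectiveSpace {n : ℕ} (w : Fin (n + 1) → ℕ) : Over (Spec (CommRingCat.of ℂ)) :=
  letI := MvPolynomial.weightedGradedAlgebra ℂ w
  projOver (MvPolynomial.weightedHomogeneousSubmodule ℂ w)

end Toric

/-! ### Reflexive simplices -/

section Simplices

variable {M : Type u} [AddCommGroup M] {n : ℕ}

/-- `w` is the system of weights of the reflexive simplex with vertices `p`. -/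
def IsWeights (p : Fin (n + 1) → M) (w : Fin (n + 1) → ℕ) : Prop :=
  (∀ i, 0 < w i) ∧ Finset.univ.gcd w = 1 ∧ ∑ i, w i • p i = 0

/-- `l 0, …, l n ∈ N` are the vertices of the simplex `Δ^*` dual to the simplex `Δ` with vertices
`p 0, …, p n`, labelled so that `⟨p i, l j⟩ = -1` for `i ≠ j`. -/
def IsDualVertices (Δ : Set (RatExt M)) (p : Fin (n + 1) → M)
    (l : Fin (n + 1) → Module.Dual ℤ M) : Prop :=
  IsSimplex (dualSet Δ) (fun j => dualToRat (l j)) ∧ ∀ i j, i ≠ j → l j (p i) = -1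

/-- The lattice `M(w) = {x ∈ ℤ^{n+1} | ∑ w_i x_i = 0}`. -/
def weightLattice (w : Fin (n + 1) → ℕ) : Submodule ℤ (Fin (n + 1) → ℤ) where
  carrier := {x | ∑ i, (w i : ℤ) * x i = 0}
  zero_mem' := by simp
  add_mem' := by
    intro a b ha hb
    simp only [Set.mem_ofPred_eq] at ha hb ⊢
    simp [mul_add, Finset.sum_add_distrib, ha, hb]
  smul_mem' := by
    intro c x hx
    simp only [Set.mem_ofPred_eq] at hx ⊢
    simp only [Pi.smul_apply, smul_eq_mul, mul_left_comm _ c, ← Finset.mul_sum, hx, mul_zero]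

lemma weight_relation {Δ : Set (RatExt M)} {p : Fin (n + 1) → M} {w : Fin (n + 1) → ℕ}
    {l : Fin (n + 1) → Module.Dual ℤ M} (hΔ : IsReflexivePair n Δ)
    (hp : IsSimplex Δ (fun i => toRat (p i))) (hw : IsWeights p w) (hl : IsDualVertices Δ p l)
    (m : M) : ∑ j, (w j : ℤ) * l j m = 0 := by
  classical
  set L : Module.Dual ℤ M := ∑ j, (w j : ℤ) • l j with hL
  have hLm : ∀ m, L m = ∑ j, (w j : ℤ) * l j m := fun m => by
    simp [hL, LinearMap.sum_apply]
  have hLp : ∀ i, L (p i) = 0 := by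
    intro i
    have h1 : ∑ j, (w j : ℤ) * l i (p j) = 0 := by
      have := congrArg (l i) hw.2.2
      simpa using this
    rw [hLm, ← h1]
    refine Finset.sum_congr rfl fun j _ => ?_
    rcases eq_or_ne i j with rfl | h
    · rfl
    · rw [hl.2 i j h, hl.2 j i h.symm]
  have hker : Δ ⊆ (LinearMap.ker (dualToRat L) : Set (RatExt M)) := by
    rw [hp.2]
    refine convexHull_min ?_ (LinearMap.ker (dualToRat L)).convex
    rintro _ ⟨i, rfl⟩
    simp [dualToRat_toRat, hLp]
  obtain ⟨ε, hε, h⟩ := hΔ.zero_interior (toRat m)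
  have h2 := hker (h ε hε.le le_rfl)
  simp only [zero_add, SetLike.mem_coe, LinearMap.mem_ker, map_smul, dualToRat_toRat,
    smul_eq_mul, mul_eq_zero, hε.ne', false_or] at h2
  rw [← hLm]
  exact_mod_cast h2

/-- The homomorphism `ι_Δ : M → M(w)`, `m ↦ (⟨m, l 0⟩, …, ⟨m, l n⟩)`. -/
def iota {Δ : Set (RatExt M)} {p : Fin (n + 1) → M} {w : Fin (n + 1) → ℕ}
    {l : Fin (n + 1) → Module.Dual ℤ M} (hΔ : IsReflexivePair n Δ)
    (hp : IsSimplex Δ (fun i => toRat (p i))) (hw : IsWeights p w) (hl : IsDualVertices Δ p l) :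
    M →ₗ[ℤ] weightLattice w :=
  LinearMap.codRestrict (weightLattice w) (LinearMap.pi l) (weight_relation hΔ hp hw hl)

/-- The polyhedron `Δ(w)`: the convex hull of the points `ι_Δ(p i)` in `M(w)_ℚ`. -/
def weightSimplex {Δ : Set (RatExt M)} {p : Fin (n + 1) → M} {w : Fin (n + 1) → ℕ}
    {l : Fin (n + 1) → Module.Dual ℤ M} (hΔ : IsReflexivePair n Δ)
    (hp : IsSimplex Δ (fun i => toRat (p i))) (hw : IsWeights p w) (hl : IsDualVertices Δ p l) :
    Set (RatExt (weightLattice w)) :=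
  convexHull ℚ (Set.range fun i => toRat (iota hΔ hp hw hl (p i)))

end Simplices

end ReflexiveSimplex

end

/-! Write `W = ∑ w i`. A simplex around the origin is governed by its vertices `P i`, the
functionals `L j` equal to `-1` on the opposite facets, and a positive relation `w` satisfied by
both families (`DualSystem`). Then `L j (P i) = -1` off the diagonal and `W / w j - 1` on it, so `(L
i x + 1) * w i / W` are the barycentric coordinates of `x`, and the simplex is cut out by `L j ≥
-1`. Reflexivity amounts to integrality of the `L j` (`exists_integral_of_isReflexivePair`,
`DualSystem.isReflexivePair`).

On `M(w)` the coordinate functions are such functionals for the points `ι_Δ(p i)`, so `Δ(w)` is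
reflexive (`dualSystem_weightSimplex`). For maximality, a finite morphism `ψ` out of `Δ(w)` leads to
a reflexive simplex `Δ'` with the same weights. The facet functionals of `Δ'` pull back to the
coordinates of `M(w)`, so `ι_Δ' ∘ ψ = id`, and `ι_Δ'` is the required factorization.

For the toric variety, `(m₀, x) ↦ (x_j + m₀)_j` maps the lattice points of the cone over `Δ(w)`
bijectively onto the exponents of weighted degree divisible by `W`. Hence `S_Δ(w)` is the `W`-th
Veronese subring of the weighted polynomial ring, and passing to a Veronese subring does not change
`Proj` (`IsVeronese.projIso`). -/

namespace ReflexiveSimplex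

/-! ### Rational extensions of lattices -/

section RationalExtension

variable {M : Type u} [AddCommGroup M]

/-- Common denominators: this reduces identities between linear maps on `M_ℚ` to lattice points. -/
lemma exists_smul_toRat_eq (x : RatExt M) : ∃ (q : ℚ) (m : M), 0 < q ∧ x = q • toRat m := by
  induction x using TensorProduct.induction_on with
  | zero => exact ⟨1, 0, one_pos, by simp⟩
  | tmul a m =>
    refine ⟨(a.den : ℚ)⁻¹, a.num • m, by simp [a.pos], ?_⟩
    change a ⊗ₜ[ℤ] m = (a.den : ℚ)⁻¹ • ((1 : ℚ) ⊗ₜ[ℤ] (a.num • m))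
    rw [← TensorProduct.smul_tmul, TensorProduct.smul_tmul']
    congr 1
    simp only [zsmul_eq_mul, mul_one, smul_eq_mul]
    rw [inv_mul_eq_div, Rat.num_div_den]
  | add x y hx hy =>
    obtain ⟨q, m, hq, rfl⟩ := hx
    obtain ⟨r, k, hr, rfl⟩ := hy
    have hd : ∀ q : ℚ, (q.den : ℚ) ≠ 0 := fun q => by exact_mod_cast q.den_nz
    refine ⟨(q.den : ℚ)⁻¹ * (r.den : ℚ)⁻¹, (q.num * r.den) • m + (r.num * q.den) • k,
      by positivity, ?_⟩
    rw [map_add, map_zsmul, map_zsmul, smul_add, ← Int.cast_smul_eq_zsmul ℚ,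
      ← Int.cast_smul_eq_zsmul ℚ (_ * _) (toRat k), smul_smul, smul_smul]
    congr 2
    · conv_lhs => rw [← Rat.num_div_den q]
      have := hd q; have := hd r; push_cast; field_simp
    · conv_lhs => rw [← Rat.num_div_den r]
      have := hd q; have := hd r; push_cast; field_simp

lemma dual_ext_toRat {f g : Module.Dual ℚ (RatExt M)} (h : ∀ m, f (toRat m) = g (toRat m)) :
    f = g := by
  refine LinearMap.ext fun x => ?_
  obtain ⟨q, m, -, rfl⟩ := exists_smul_toRat_eq x
  simp [h]

lemma dualToRat_injective : Function.Injective (dualToRat (M := M)) := by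
  intro l l' h
  ext m
  have := congrArg (fun f => f (toRat m)) h
  simpa [dualToRat_toRat] using this

lemma dualToRat_neg (l : Module.Dual ℤ M) : dualToRat (-l) = -dualToRat l :=
  dual_ext_toRat fun m => by simp [dualToRat_toRat]

lemma toRat_injective [Module.Free ℤ M] : Function.Injective (toRat (M := M)) := by
  intro m m' h
  refine (Module.forall_dual_apply_eq_zero_iff ℤ (m - m')).1 (fun l => ?_) |> sub_eq_zero.1
  have := congrArg (dualToRat l) h
  simp only [dualToRat_toRat, Int.cast_inj] at this
  rw [map_sub, this, sub_self]

lemma baseChange_toRat {M' : Type v} [AddCommGroup M'] (φ : M →ₗ[ℤ] M') (m : M) :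
    φ.baseChange ℚ (toRat m) = toRat (φ m) :=
  LinearMap.baseChange_tmul (A := ℚ) φ 1 m

end RationalExtension

/-! ### Systems of vertices and facet functionals of simplices around the origin -/

section DualSystem

variable {V : Type u} [AddCommGroup V] [Module ℚ V] {n : ℕ}

/-- The points `P i` are the vertices of a simplex around the origin satisfying the positive linear
relation `w`, and the linear functions `L j` take the value `-1` on the facet opposite to `P j`. -/
structure DualSystem (w : Fin (n + 1) → ℕ) (P : Fin (n + 1) → V)
    (L : Fin (n + 1) → Module.Dual ℚ V) : Prop where
  pos : ∀ i, 0 < w i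
  sum_smul : ∑ i, (w i : ℚ) • P i = 0
  sum_smul_dual : ∑ j, (w j : ℚ) • L j = 0
  apply_of_ne : ∀ i j, i ≠ j → L j (P i) = -1
  -- This replaces any assumption on dimension: that the `P i` span `V` and that `V` has dimension
  -- `n` are derived from it.
  separating : ∀ x, (∀ j, L j x = 0) → x = 0

namespace DualSystem

variable {w : Fin (n + 1) → ℕ} {P : Fin (n + 1) → V} {L : Fin (n + 1) → Module.Dual ℚ V}

section

variable (h : DualSystem w P L)
include h

lemma cast_pos (i : Fin (n + 1)) : (0 : ℚ) < w i := by exact_mod_cast h.pos i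

lemma total_pos : (0 : ℚ) < ∑ i, (w i : ℚ) :=
  Finset.sum_pos (fun i _ => h.cast_pos i) Finset.univ_nonempty

lemma sum_mul_apply (x : V) : ∑ j, (w j : ℚ) * L j x = 0 := by
  simpa using congrArg (fun f => f x) h.sum_smul_dual

/-- Apply `L j` to the relation `∑ w i • P i = 0`; every term with `i ≠ j` contributes `-w i`. -/
lemma mul_apply_self (j : Fin (n + 1)) : (w j : ℚ) * (L j (P j) + 1) = ∑ i, (w i : ℚ) := by
  have h1 : ∑ i, (w i : ℚ) * (L j (P i) + 1) = ∑ i, (w i : ℚ) := by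
    have := congrArg (L j) h.sum_smul
    simp only [map_sum, map_smul, smul_eq_mul, map_zero] at this
    simp [mul_add, Finset.sum_add_distrib, this]
  rw [← h1, Finset.sum_eq_single j]
  · intro i _ hij
    rw [h.apply_of_ne i j hij]; simp
  · simp

lemma apply_self (j : Fin (n + 1)) : L j (P j) = (∑ i, (w i : ℚ)) / w j - 1 := by
  rw [← h.mul_apply_self j]
  have := (h.cast_pos j).ne'
  field_simp
  ring

lemma apply_vertex (i j : Fin (n + 1)) :
    L j (P i) = -1 + if i = j then (∑ i, (w i : ℚ)) / w j else 0 := by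
  split_ifs with hij
  · subst hij; rw [h.apply_self]; ring
  · rw [h.apply_of_ne i j hij]; simp

lemma sum_coord (x : V) : ∑ i, (L i x + 1) * w i / (∑ i, (w i : ℚ)) = 1 := by
  rw [← Finset.sum_div, div_eq_one_iff_eq h.total_pos.ne']
  simp only [add_mul, one_mul, Finset.sum_add_distrib]
  have := h.sum_mul_apply x
  simp only [mul_comm] at this ⊢
  rw [this, zero_add]

/-- Barycentric coordinates in terms of the facet functionals: both sides take the same value under
every `L j`, and these separate points. -/
lemma sum_coord_smul (x : V) : ∑ i, ((L i x + 1) * w i / (∑ i, (w i : ℚ))) • P i = x := by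
  rw [← sub_eq_zero]
  refine h.separating _ fun j => ?_
  have h1 := h.sum_coord x
  have hW := h.total_pos.ne'
  have hj := (h.cast_pos j).ne'
  simp only [map_sub, map_sum, map_smul, smul_eq_mul, h.apply_vertex, mul_add, mul_neg, mul_one,
    Finset.sum_add_distrib, Finset.sum_neg_distrib, h1, mul_ite, mul_zero, Finset.sum_ite_eq',
    Finset.mem_univ, if_true]
  field_simp
  ring

lemma dual_ext {f g : Module.Dual ℚ V} (hfg : ∀ i, f (P i) = g (P i)) : f = g := by
  ext x
  rw [← h.sum_coord_smul x]
  simp [hfg]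

/-- Since `w j ≠ 0`, the relation among the `P i` determines the value at `P j` from the others. -/
lemma eq_of_apply_of_ne {f g : Module.Dual ℚ V} {j : Fin (n + 1)}
    (hfg : ∀ i, i ≠ j → f (P i) = g (P i)) : f = g := by
  refine h.dual_ext fun i => ?_
  rcases eq_or_ne i j with rfl | hij
  · have h1 := congrArg (f - g) h.sum_smul
    rw [map_sum, map_zero, Finset.sum_eq_single i] at h1
    · simpa [sub_eq_zero, (h.cast_pos i).ne', h.pos i |>.ne'] using h1
    · intro k _ hk
      simp [hfg k hk]
    · simp
  · exact hfg i hij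

/-- The inequality `-1 ≤ L j x` says exactly that the `j`-th barycentric coordinate is nonnegative.
-/
lemma convexHull_eq : convexHull ℚ (Set.range P) = {x | ∀ j, -1 ≤ L j x} := by
  have hW := h.total_pos
  apply subset_antisymm
  · refine convexHull_min ?_ ?_
    · rintro _ ⟨i, rfl⟩ j
      rw [h.apply_vertex]
      have := h.cast_pos j
      split_ifs
      · have : 0 ≤ (∑ i, (w i : ℚ)) / w j := by positivity
        linarith
      · simp
    · have : {x | ∀ j, -1 ≤ L j x} = ⋂ j, {x | -1 ≤ L j x} := by ext; simp
      rw [this]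
      exact convex_iInter fun j => convex_halfSpace_ge (L j).isLinear _
  · intro x hx
    rw [← h.sum_coord_smul x]
    refine (convex_convexHull ℚ _).sum_mem (fun i _ => ?_) (h.sum_coord x)
      fun i _ => subset_convexHull ℚ _ ⟨i, rfl⟩
    have := h.cast_pos i
    have := hx i
    have : 0 ≤ L i x + 1 := by linarith
    positivity

/-- The conditions are symmetric in `P` and `L`, so every fact about the simplex transfers to its
dual. -/
lemma dual : DualSystem w L (fun i => Module.Dual.eval ℚ V (P i)) where
  pos := h.pos
  sum_smul := h.sum_smul_dual
  sum_smul_dual := by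
    have := congrArg (Module.Dual.eval ℚ V) h.sum_smul
    simpa using this
  apply_of_ne i j hij := h.apply_of_ne j i hij.symm
  separating f hf := h.dual_ext fun i => by simpa using hf i

lemma dualSet_eq : dualSet (convexHull ℚ (Set.range P)) = convexHull ℚ (Set.range L) := by
  rw [h.dual.convexHull_eq]
  ext y
  refine ⟨fun hy i => hy _ (subset_convexHull ℚ _ ⟨i, rfl⟩), fun hy x hx => ?_⟩
  refine convexHull_min (t := {x | -1 ≤ y x}) ?_ (convex_halfSpace_ge y.isLinear _) hx
  rintro _ ⟨i, rfl⟩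
  exact hy i

lemma affineIndependent : AffineIndependent ℚ P := by
  rw [affineIndependent_iff]
  intro s c hc hcP i hi
  have h1 := congrArg (L i) hcP
  simp only [map_sum, map_smul, smul_eq_mul, h.apply_vertex, mul_add, mul_neg, mul_one,
    Finset.sum_add_distrib, Finset.sum_neg_distrib, hc, mul_ite, mul_zero, Finset.sum_ite_eq', hi,
    if_true, map_zero, neg_zero, zero_add] at h1
  have := div_pos h.total_pos (h.cast_pos i)
  simpa [this.ne', h.total_pos.ne', (h.cast_pos i).ne'] using h1

lemma span_eq_top : Submodule.span ℚ (Set.range P) = ⊤ := by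
  refine eq_top_iff.2 fun x _ => ?_
  rw [← h.sum_coord_smul x]
  exact Submodule.sum_mem _ fun i _ => Submodule.smul_mem _ _ (Submodule.subset_span ⟨i, rfl⟩)

lemma finiteDimensional : FiniteDimensional ℚ V :=
  ⟨⟨(Set.finite_range P).toFinset, by simpa using h.span_eq_top⟩⟩

lemma affineSpan_eq_top : affineSpan ℚ (Set.range P) = ⊤ := by
  refine eq_top_iff.2 fun x _ => ?_
  rw [← h.sum_coord_smul x,
    ← Finset.univ.affineCombination_eq_linear_combination _ _ (h.sum_coord x)]
  exact affineCombination_mem_affineSpan (h.sum_coord x) P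

lemma finrank_eq : Module.finrank ℚ V = n := by
  have := h.finiteDimensional
  have := h.affineIndependent.affineSpan_eq_top_iff_card_eq_finrank_add_one.1 h.affineSpan_eq_top
  simpa using this.symm

lemma isInteriorPoint_zero : IsInteriorPoint (convexHull ℚ (Set.range P)) 0 := by
  intro v
  rw [h.convexHull_eq]
  have hpos : 0 < 1 + ∑ j, |L j v| := by positivity
  refine ⟨(1 + ∑ j, |L j v|)⁻¹, by positivity, fun t ht htε j => ?_⟩
  simp only [zero_add, map_smul, smul_eq_mul]
  have h1 : |L j v| ≤ 1 + ∑ j, |L j v| := by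
    have := Finset.single_le_sum (f := fun j => |L j v|) (fun j _ => abs_nonneg _)
      (Finset.mem_univ j)
    linarith
  have h2 : t * |L j v| ≤ 1 := by
    calc t * |L j v| ≤ (1 + ∑ j, |L j v|)⁻¹ * (1 + ∑ j, |L j v|) := by gcongr
      _ = 1 := inv_mul_cancel₀ hpos.ne'
  have h3 := mul_le_mul_of_nonneg_left (neg_abs_le (L j v)) ht
  linarith

/-- A face of the simplex on which some vertex is missing lies in the opposite facet. -/
lemma exists_subset_of_isFace {Θ : Set V} (hΘ : IsFace (convexHull ℚ (Set.range P)) Θ)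
    (hne : Module.finrank ℚ (vectorSpan ℚ Θ) ≠ n) : ∃ j, ∀ x ∈ Θ, L j x = -1 := by
  obtain ⟨-, y, c, hc, rfl⟩ := hΘ
  by_contra! hcon
  refine hne ?_
  -- A point of the face off the facet `L j = -1` has positive `j`-th coordinate. As `y` attains its
  -- lower bound `c` there, `y (P j) = c`. If this happens for all `j`, the face contains all
  -- vertices and has full dimension.
  have hall : ∀ j, y (P j) = c := by
    intro j
    obtain ⟨x, ⟨hxP, hxc⟩, hxj⟩ := hcon j
    rw [h.convexHull_eq] at hxP
    have h0 : ∀ i, 0 ≤ (L i x + 1) * w i / (∑ i, (w i : ℚ)) := fun i => by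
      have := h.cast_pos i
      have := h.total_pos
      have : 0 ≤ L i x + 1 := by linarith [hxP i]
      positivity
    have h1 : ∑ i, ((L i x + 1) * w i / (∑ i, (w i : ℚ))) * (y (P i) - c) = 0 := by
      have h2 := congrArg y (h.sum_coord_smul x)
      simp only [map_sum, map_smul, smul_eq_mul] at h2
      simp only [mul_sub, Finset.sum_sub_distrib, ← Finset.sum_mul, h.sum_coord, h2, hxc]
      simp
    have h3 := (Finset.sum_eq_zero_iff_of_nonneg (fun i _ => mul_nonneg (h0 i)
      (sub_nonneg.2 (hc _ (subset_convexHull ℚ _ ⟨i, rfl⟩))))).1 h1 j (Finset.mem_univ j)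
    have h4 : (L j x + 1) * w j / (∑ i, (w i : ℚ)) ≠ 0 :=
      div_ne_zero (mul_ne_zero (fun h => hxj (by linarith)) (h.cast_pos j).ne') h.total_pos.ne'
    simpa [h4, sub_eq_zero] using h3
  have hsub : Set.range P ⊆ {x ∈ convexHull ℚ (Set.range P) | y x = c} := by
    rintro _ ⟨i, rfl⟩
    exact ⟨subset_convexHull ℚ _ ⟨i, rfl⟩, hall i⟩
  have htop : vectorSpan ℚ {x ∈ convexHull ℚ (Set.range P) | y x = c} = ⊤ := by
    refine eq_top_iff.2 ?_
    have := vectorSpan_mono ℚ hsub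
    rwa [← direction_affineSpan ℚ (Set.range P), h.affineSpan_eq_top,
      AffineSubspace.direction_top] at this
  rw [htop, finrank_top, h.finrank_eq]

end

end DualSystem

lemma affineSpan_eq_hyperplane [FiniteDimensional ℚ V] {f : Module.Dual ℚ V} (hf : f ≠ 0) {c : ℚ}
    {Θ : Set V} (hne : Θ.Nonempty) (hΘ : ∀ x ∈ Θ, f x = c)
    (hrank : Module.finrank ℚ (vectorSpan ℚ Θ) + 1 = Module.finrank ℚ V) :
    (affineSpan ℚ Θ : Set V) = {x | f x = c} := by
  obtain ⟨x₀, hx₀⟩ := hne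
  have hle : vectorSpan ℚ Θ ≤ LinearMap.ker f := by
    rw [vectorSpan_def, Submodule.span_le]
    rintro _ ⟨x, hx, y, hy, rfl⟩
    simp [hΘ x hx, hΘ y hy]
  have hker := Module.Dual.finrank_ker_add_one_of_ne_zero hf
  have heq : vectorSpan ℚ Θ = LinearMap.ker f :=
    Submodule.eq_of_le_of_finrank_eq hle (by omega)
  ext x
  have hx₀' : x₀ ∈ affineSpan ℚ Θ := subset_affineSpan ℚ _ hx₀
  rw [SetLike.mem_coe, ← AffineSubspace.vsub_right_mem_direction_iff_mem hx₀', direction_affineSpan,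
    heq]
  simp [hΘ x₀ hx₀, sub_eq_zero]

end DualSystem

/-! ### Reflexive simplices and dual systems -/

section ReflexiveSimplices

variable {M : Type u} [AddCommGroup M] {n : ℕ}

/-- A face of codimension one spans some hyperplane `l j = -1`, and `l j` is primitive because it
takes the value `-1` at a lattice point. -/
lemma DualSystem.isReflexivePair [Module.Free ℤ M] [Module.Finite ℤ M] {w : Fin (n + 1) → ℕ}
    {p : Fin (n + 1) → M} {l : Fin (n + 1) → Module.Dual ℤ M}
    (h : DualSystem w (fun i => toRat (p i)) (fun j => dualToRat (l j))) :
    IsReflexivePair n (convexHull ℚ (Set.range fun i => toRat (p i))) where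
  free := inferInstance
  finite := inferInstance
  rank_eq := by rw [← h.finrank_eq, Module.finrank_baseChange]
  integral := by
    classical
    refine ⟨Finset.univ.image p, ?_⟩
    rw [Finset.coe_image, Finset.coe_univ, Set.image_univ, ← Set.range_comp]
    rfl
  zero_interior := h.isInteriorPoint_zero
  distance Θ hΘ hrank := by
    obtain ⟨j, hj⟩ := h.exists_subset_of_isFace hΘ (by omega)
    obtain ⟨i, hij⟩ : ∃ i, i ≠ j := by
      have : Nontrivial (Fin (n + 1)) := Fin.nontrivial_iff_two_le.2 (by omega)
      exact exists_ne j
    have hval : l j (p i) = -1 := by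
      have := h.apply_of_ne i j hij
      rw [dualToRat_toRat] at this
      exact_mod_cast this
    have := h.finiteDimensional
    refine ⟨l j, -1, fun k l' hk => ?_, ?_, by simp⟩
    · rw [hk, LinearMap.smul_apply, smul_eq_mul] at hval
      exact IsUnit.of_mul_eq_one (-(l' (p i))) (by linarith)
    · have hne : dualToRat (l j) ≠ 0 := fun h0 => by
        have := h.apply_of_ne i j hij
        simp [h0] at this
      rw [affineSpan_eq_hyperplane hne hΘ.1 hj (by rw [hrank, h.finrank_eq])]
      simp

lemma finrank_eq_of_isReflexivePair {Δ : Set (RatExt M)} (hΔ : IsReflexivePair n Δ) :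
    Module.finrank ℚ (RatExt M) = n := by
  have := hΔ.free
  rw [Module.finrank_baseChange, hΔ.rank_eq]

lemma finiteDimensional_of_isReflexivePair {Δ : Set (RatExt M)} (hΔ : IsReflexivePair n Δ) :
    FiniteDimensional ℚ (RatExt M) := by
  have := hΔ.finite
  infer_instance

/-! ### Weights, facet functionals and facets of a rational simplex around the origin. -/

section Weights

variable {V : Type u} [AddCommGroup V] [Module ℚ V]

/-- A small multiple `-ε • P i` lies in the hull; moving it to the other side of its convex
combination gives the relation. -/
lemma exists_nonneg_relation {P : Fin (n + 1) → V}
    (h0 : IsInteriorPoint (convexHull ℚ (Set.range P)) 0) (i : Fin (n + 1)) :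
    ∃ a : Fin (n + 1) → ℚ, (∀ k, 0 ≤ a k) ∧ 0 < a i ∧ ∑ k, a k • P k = 0 := by
  classical
  obtain ⟨ε, hε, h⟩ := h0 (-P i)
  have h1 := h ε hε.le le_rfl
  rw [zero_add, convexHull_range_eq_exists_affineCombination] at h1
  obtain ⟨s, b, hb0, hb1, hb⟩ := h1
  rw [Finset.affineCombination_eq_linear_combination _ _ _ hb1] at hb
  refine ⟨fun k => (if k ∈ s then b k else 0) + if k = i then ε else 0, fun k => ?_, ?_, ?_⟩
  · have : 0 ≤ if k ∈ s then b k else 0 := by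
      split_ifs with hk
      exacts [hb0 k hk, le_rfl]
    have : 0 ≤ if k = i then ε else 0 := by split_ifs <;> simp [hε.le]
    positivity
  · have : 0 ≤ if i ∈ s then b i else 0 := by
      split_ifs with hk
      exacts [hb0 i hk, le_rfl]
    simp only [if_true]
    positivity
  · simp only [add_smul, ite_smul, zero_smul, Finset.sum_add_distrib, Finset.sum_ite_eq',
      Finset.mem_univ, if_true, Finset.sum_ite_mem, Finset.univ_inter, hb]
    simp

lemma exists_pos_relation {P : Fin (n + 1) → V}
    (h0 : IsInteriorPoint (convexHull ℚ (Set.range P)) 0) :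
    ∃ a : Fin (n + 1) → ℚ, (∀ k, 0 < a k) ∧ ∑ k, a k • P k = 0 := by
  choose a ha0 hai ha using exists_nonneg_relation h0
  refine ⟨fun k => ∑ i, a i k, fun k => ?_, ?_⟩
  · exact Finset.sum_pos' (fun i _ => ha0 i k) ⟨k, Finset.mem_univ _, hai k⟩
  · simp only [Finset.sum_smul]
    rw [Finset.sum_comm]
    exact Finset.sum_eq_zero fun i _ => ha i

lemma exists_nat_relation {P : Fin (n + 1) → V}
    (h0 : IsInteriorPoint (convexHull ℚ (Set.range P)) 0) :
    ∃ w : Fin (n + 1) → ℕ, (∀ k, 0 < w k) ∧ Finset.univ.gcd w = 1 ∧ ∑ k, w k • P k = 0 := by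
  obtain ⟨a, ha, haP⟩ := exists_pos_relation h0
  set D : ℕ := ∏ k, (a k).den
  have hD : D ≠ 0 := Finset.prod_ne_zero_iff.2 fun k _ => (a k).den_nz
  have hint : ∀ k, ∃ b : ℕ, (b : ℚ) = D * a k := fun k => by
    obtain ⟨e, he⟩ : (a k).den ∣ D := Finset.dvd_prod_of_mem _ (Finset.mem_univ k)
    refine ⟨e * (a k).num.toNat, ?_⟩
    have hnum : (((a k).num.toNat : ℕ) : ℚ) = (a k).num := by
      exact_mod_cast Int.toNat_of_nonneg (Rat.num_nonneg.2 (ha k).le)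
    rw [he, Nat.cast_mul, Nat.cast_mul, hnum]
    have h2 : ((a k).den : ℚ) * a k = (a k).num := by
      rw [mul_comm]
      exact Rat.mul_den_eq_num _
    rw [← h2]; ring
  choose b hb using hint
  have hbpos : ∀ k, 0 < b k := fun k => by
    have : (0 : ℚ) < b k := by
      rw [hb]
      have := ha k
      have : (0 : ℚ) < D := by exact_mod_cast Nat.pos_of_ne_zero hD
      positivity
    exact_mod_cast this
  obtain ⟨w, hw, hgcd⟩ := Finset.extract_gcd b (Finset.univ_nonempty (α := Fin (n + 1)))
  have hg : Finset.univ.gcd b ≠ 0 := fun h =>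
    (hbpos 0).ne' (Finset.gcd_eq_zero_iff.1 h 0 (Finset.mem_univ _))
  refine ⟨w, fun k => Nat.pos_of_ne_zero fun hk => (hbpos k).ne' ?_, hgcd, ?_⟩
  · rw [hw k (Finset.mem_univ _), hk, mul_zero]
  · have h1 : ((Finset.univ.gcd b : ℕ) : ℚ) • ∑ k, w k • P k = (D : ℚ) • ∑ k, a k • P k := by
      rw [Finset.smul_sum, Finset.smul_sum]
      refine Finset.sum_congr rfl fun k _ => ?_
      rw [smul_smul, ← hb, ← Nat.cast_smul_eq_nsmul ℚ (w k), smul_smul,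
        hw k (Finset.mem_univ _)]
      push_cast; rfl
    rw [haP, smul_zero] at h1
    exact (smul_eq_zero.1 h1).resolve_left (by exact_mod_cast hg)

/-- Scaling each relation by the total of the other makes the coefficients of the difference sum to
zero, so affine independence gives proportionality; comparing gcds then identifies the totals. -/
lemma relation_unique {P : Fin (n + 1) → V} (hP : AffineIndependent ℚ P) {w w' : Fin (n + 1) → ℕ}
    (hw : ∀ k, 0 < w k) (hw1 : Finset.univ.gcd w = 1) (hwP : ∑ k, w k • P k = 0)
    (hw1' : Finset.univ.gcd w' = 1) (hwP' : ∑ k, w' k • P k = 0) : w = w' := by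
  have hrel : ∀ k, (∑ i, w' i) * w k = (∑ i, w i) * w' k := by
    intro k
    have := (affineIndependent_iff.1 hP) Finset.univ
      (fun k => ((∑ i, w' i : ℕ) : ℚ) * w k - ((∑ i, w i : ℕ) : ℚ) * w' k) ?_ ?_ k
      (Finset.mem_univ _)
    · rw [sub_eq_zero] at this
      exact_mod_cast this
    · rw [Finset.sum_sub_distrib, ← Finset.mul_sum, ← Finset.mul_sum]
      push_cast
      ring
    · have e : ∀ w : Fin (n + 1) → ℕ, ∑ k, w k • P k = 0 → ∑ k, (w k : ℚ) • P k = 0 := by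
        intro w hw
        simpa only [Nat.cast_smul_eq_nsmul] using hw
      simp only [sub_smul, mul_smul, Finset.sum_sub_distrib, ← Finset.smul_sum, e w hwP,
        e w' hwP', smul_zero, sub_zero]
  have hsum : ∑ i, w' i = ∑ i, w i := by
    have := congrArg Finset.univ.gcd (funext hrel)
    simpa only [Finset.gcd_mul_left, hw1, hw1', normalize_eq, mul_one] using this
  have hpos : 0 < ∑ i, w i := Finset.sum_pos (fun i _ => hw i) Finset.univ_nonempty
  funext k
  have := hrel k
  rw [hsum] at this
  exact Nat.eq_of_mul_eq_mul_left hpos this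

lemma exists_dualSystem {P : Fin (n + 1) → V} (hP : AffineIndependent ℚ P)
    [FiniteDimensional ℚ V] (hrank : Module.finrank ℚ V = n) {w : Fin (n + 1) → ℕ}
    (hw : ∀ k, 0 < w k) (hwP : ∑ k, w k • P k = 0) :
    ∃ L : Fin (n + 1) → Module.Dual ℚ V, DualSystem w P L := by
  have htop : affineSpan ℚ (Set.range P) = ⊤ :=
    hP.affineSpan_eq_top_iff_card_eq_finrank_add_one.2 (by simp [hrank])
  let b : AffineBasis (Fin (n + 1)) ℚ V := ⟨P, hP, htop⟩
  have hwpos : ∀ k, (0 : ℚ) < w k := fun k => by exact_mod_cast hw k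
  have hW : (0 : ℚ) < ∑ k, (w k : ℚ) := Finset.sum_pos (fun k _ => hwpos k) Finset.univ_nonempty
  have hwP' : ∑ k, (w k : ℚ) • P k = 0 := by simpa only [Nat.cast_smul_eq_nsmul] using hwP
  have hlin : ∀ j x, (b.coord j).linear x = b.coord j x - b.coord j 0 := fun j x => by
    have := (b.coord j).linearMap_vsub x 0
    simpa using this
  have hbP : ∀ i j, b.coord j (P i) = if j = i then 1 else 0 := fun i j => b.coord_apply j i
  have hzero : ∀ j, b.coord j 0 = w j / ∑ k, (w k : ℚ) := by
    intro j
    have h1 : ∑ k, (w k : ℚ) * (b.coord j).linear (P k) = 0 := by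
      have := congrArg (b.coord j).linear hwP'
      simpa using this
    simp only [hlin, hbP, mul_sub, mul_ite, mul_one, mul_zero, Finset.sum_sub_distrib,
      Finset.sum_ite_eq, Finset.mem_univ, if_true, ← Finset.sum_mul] at h1
    rw [eq_div_iff hW.ne']
    linarith
  -- The `j`-th barycentric coordinate is `w j / W` at `0` and `0` on the opposite facet, so this
  -- factor normalizes its linear part to `-1` there.
  refine ⟨fun j => ((∑ k, (w k : ℚ)) / w j) • (b.coord j).linear, hw, hwP', ?_, ?_, ?_⟩
  · ext x
    have h1 : ∑ j, (b.coord j).linear x = 0 := by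
      simp only [hlin, Finset.sum_sub_distrib, b.sum_coord_apply_eq_one, sub_self]
    simp only [LinearMap.sum_apply, LinearMap.smul_apply, smul_eq_mul, LinearMap.zero_apply]
    rw [← mul_zero (∑ k, (w k : ℚ)), ← h1, Finset.mul_sum]
    refine Finset.sum_congr rfl fun j _ => ?_
    have := (hwpos j).ne'
    field_simp
  · intro i j hij
    have := (hwpos j).ne'
    have := hW.ne'
    simp only [LinearMap.smul_apply, smul_eq_mul, hlin, hbP, hzero, hij.symm, if_false]
    field_simp
    ring
  · intro x hx
    refine b.ext_elem fun j => ?_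
    have h1 := hx j
    have h2 : (∑ k, (w k : ℚ)) / w j ≠ 0 := (div_pos hW (hwpos j)).ne'
    simp only [LinearMap.smul_apply, smul_eq_mul, mul_eq_zero, h2, false_or, hlin] at h1
    exact sub_eq_zero.1 h1

lemma DualSystem.isFace_facet {w : Fin (n + 1) → ℕ} {P : Fin (n + 1) → V}
    {L : Fin (n + 1) → Module.Dual ℚ V} (h : DualSystem w P L) (hn : n ≠ 0) (j : Fin (n + 1)) :
    IsFace (convexHull ℚ (Set.range P)) {x ∈ convexHull ℚ (Set.range P) | L j x = -1} := by
  have : Nontrivial (Fin (n + 1)) := Fin.nontrivial_iff_two_le.2 (by omega)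
  obtain ⟨i, hij⟩ := exists_ne j
  refine ⟨⟨P i, subset_convexHull ℚ _ ⟨i, rfl⟩, h.apply_of_ne i j hij⟩, L j, -1, ?_, rfl⟩
  rw [h.convexHull_eq]
  exact fun x hx => hx j

/-- The kernel of `L j` bounds the dimension from above, the `n` affinely independent vertices other
than `P j` from below. -/
lemma DualSystem.finrank_facet {w : Fin (n + 1) → ℕ} {P : Fin (n + 1) → V}
    {L : Fin (n + 1) → Module.Dual ℚ V} (h : DualSystem w P L) (hn : n ≠ 0) (j : Fin (n + 1)) :
    Module.finrank ℚ (vectorSpan ℚ {x ∈ convexHull ℚ (Set.range P) | L j x = -1}) + 1 = n := by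
  have := h.finiteDimensional
  have : Nontrivial (Fin (n + 1)) := Fin.nontrivial_iff_two_le.2 (by omega)
  obtain ⟨i, hij⟩ := exists_ne j
  have hne : L j ≠ 0 := fun h0 => by
    have := h.apply_of_ne i j hij
    simp [h0] at this
  have hker := Module.Dual.finrank_ker_add_one_of_ne_zero hne
  rw [h.finrank_eq] at hker
  have hle : vectorSpan ℚ {x ∈ convexHull ℚ (Set.range P) | L j x = -1} ≤ LinearMap.ker (L j) := by
    rw [vectorSpan_def, Submodule.span_le]
    rintro _ ⟨x, hx, y, hy, rfl⟩
    simp [hx.2, hy.2]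
  have h1 := Submodule.finrank_mono hle
  have hsub : Set.range (fun i : {i // i ≠ j} => P i) ⊆
      {x ∈ convexHull ℚ (Set.range P) | L j x = -1} := by
    rintro _ ⟨i, rfl⟩
    exact ⟨subset_convexHull ℚ _ ⟨i, rfl⟩, h.apply_of_ne i j i.2⟩
  have h2 := Submodule.finrank_mono (vectorSpan_mono ℚ hsub)
  have hind := h.affineIndependent.comp_embedding (Function.Embedding.subtype (· ≠ j))
  have h3 := hind.finrank_vectorSpan (n := n - 1) (by
    rw [Fintype.card_subtype_compl]; simp; omega)
  have h4 : (P ∘ (Function.Embedding.subtype (· ≠ j))) = fun i : {i // i ≠ j} => P i := rfl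
  rw [h4] at h3
  omega

end Weights

lemma exists_integral_of_isReflexivePair {Δ : Set (RatExt M)} (hΔ : IsReflexivePair n Δ)
    {p : Fin (n + 1) → M} (hp : IsSimplex Δ (fun i => toRat (p i))) {w : Fin (n + 1) → ℕ}
    {L : Fin (n + 1) → Module.Dual ℚ (RatExt M)} (h : DualSystem w (fun i => toRat (p i)) L)
    (j : Fin (n + 1)) : ∃ l : Module.Dual ℤ M, dualToRat l = L j := by
  have := h.finiteDimensional
  -- For `n = 0` there is no face of codimension one to use, but the dual space is zero.
  rcases eq_or_ne n 0 with rfl | hn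
  · have : Subsingleton (RatExt M) := Module.finrank_zero_iff.1 h.finrank_eq
    exact ⟨0, Subsingleton.elim _ _⟩
  obtain ⟨-, rfl⟩ := hp
  have : Nontrivial (Fin (n + 1)) := Fin.nontrivial_iff_two_le.2 (by omega)
  have hface := h.isFace_facet hn j
  have hrank := h.finrank_facet hn j
  obtain ⟨l, c, -, hH, hc⟩ := hΔ.distance _ hface hrank
  have hval : ∀ i, i ≠ j → (l (p i) : ℚ) = c := by
    intro i hij
    have hi : toRat (p i) ∈ (affineSpan ℚ
        {x ∈ convexHull ℚ (Set.range fun i => toRat (p i)) | L j x = -1} : Set (RatExt M)) :=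
      subset_affineSpan ℚ _ ⟨subset_convexHull ℚ _ ⟨i, rfl⟩, h.apply_of_ne i j hij⟩
    rw [hH] at hi
    simpa [dualToRat_toRat] using hi
  rw [map_zero, sub_zero] at hc
  -- Distance `1` only gives `c = ±1`; the sign of `l` is chosen to make the value `-1`.
  obtain ⟨l', hl'⟩ : ∃ l' : Module.Dual ℤ M, ∀ i, i ≠ j → dualToRat l' (toRat (p i)) = -1 := by
    rcases eq_or_eq_neg_of_abs_eq hc with rfl | rfl
    · exact ⟨-l, fun i hij => by simp [dualToRat_neg, dualToRat_toRat, hval i hij]⟩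
    · exact ⟨l, fun i hij => by simp [dualToRat_toRat, hval i hij]⟩
  refine ⟨l', h.eq_of_apply_of_ne (j := j) fun i hij => ?_⟩
  rw [hl' i hij, h.apply_of_ne i j hij]

lemma isWeights_iff {p : Fin (n + 1) → M} {w : Fin (n + 1) → ℕ} [Module.Free ℤ M] :
    IsWeights p w ↔
      (∀ i, 0 < w i) ∧ Finset.univ.gcd w = 1 ∧ ∑ i, w i • toRat (p i) = 0 := by
  have : ∑ i, w i • toRat (p i) = toRat (∑ i, w i • p i) := by simp
  rw [IsWeights, this, ← map_zero (toRat (M := M)), toRat_injective.eq_iff]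

lemma existsUnique_isWeights {Δ : Set (RatExt M)} (hΔ : IsReflexivePair n Δ)
    {p : Fin (n + 1) → M} (hp : IsSimplex Δ (fun i => toRat (p i))) :
    ∃! w : Fin (n + 1) → ℕ, IsWeights p w := by
  have := hΔ.free
  simp only [isWeights_iff]
  obtain ⟨hind, rfl⟩ := hp
  obtain ⟨w, hw⟩ := exists_nat_relation hΔ.zero_interior
  exact ⟨w, hw, fun w' hw' =>
    relation_unique hind hw'.1 hw'.2.1 hw'.2.2 hw.2.1 hw.2.2⟩

lemma DualSystem.isDualVertices {w : Fin (n + 1) → ℕ} {p : Fin (n + 1) → M}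
    {l : Fin (n + 1) → Module.Dual ℤ M}
    (h : DualSystem w (fun i => toRat (p i)) (fun j => dualToRat (l j))) :
    IsDualVertices (convexHull ℚ (Set.range fun i => toRat (p i))) p l := by
  refine ⟨⟨h.dual.affineIndependent, h.dualSet_eq⟩, fun i j hij => ?_⟩
  have := h.apply_of_ne i j hij
  rw [dualToRat_toRat] at this
  exact_mod_cast this

lemma exists_dualSystem_of_isWeights {Δ : Set (RatExt M)} (hΔ : IsReflexivePair n Δ)
    {p : Fin (n + 1) → M} (hp : IsSimplex Δ (fun i => toRat (p i))) {w : Fin (n + 1) → ℕ}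
    (hw : IsWeights p w) : ∃ l : Fin (n + 1) → Module.Dual ℤ M,
      DualSystem w (fun i => toRat (p i)) (fun j => dualToRat (l j)) := by
  have := hΔ.free
  have := finiteDimensional_of_isReflexivePair hΔ
  obtain ⟨L, hL⟩ := exists_dualSystem hp.1 (finrank_eq_of_isReflexivePair hΔ) hw.1
    (isWeights_iff.1 hw).2.2
  choose l hl using exists_integral_of_isReflexivePair hΔ hp hL
  exact ⟨l, by simpa only [hl] using hL⟩

lemma existsUnique_isDualVertices {Δ : Set (RatExt M)} (hΔ : IsReflexivePair n Δ)
    {p : Fin (n + 1) → M} (hp : IsSimplex Δ (fun i => toRat (p i))) :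
    ∃! l : Fin (n + 1) → Module.Dual ℤ M, IsDualVertices Δ p l := by
  obtain ⟨w, hw, -⟩ := existsUnique_isWeights hΔ hp
  obtain ⟨l, hl⟩ := exists_dualSystem_of_isWeights hΔ hp hw
  have hl' := hl.isDualVertices
  rw [← hp.2] at hl'
  refine ⟨l, hl', fun k hk => funext fun j => dualToRat_injective ?_⟩
  refine hl.eq_of_apply_of_ne (j := j) fun i hij => ?_
  rw [dualToRat_toRat, dualToRat_toRat, hk.2 i j hij, hl'.2 i j hij]

end ReflexiveSimplices

/-! ### The simplex `Δ(w)` -/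

section WeightSimplex

variable {M : Type u} [AddCommGroup M] {n : ℕ}

/-- The `j`-th coordinate function on `M(w)`. -/
def weightCoord (w : Fin (n + 1) → ℕ) (j : Fin (n + 1)) : Module.Dual ℤ (weightLattice w) :=
  LinearMap.proj j ∘ₗ (weightLattice w).subtype

@[simp]
lemma weightCoord_apply (w : Fin (n + 1) → ℕ) (j : Fin (n + 1)) (x : weightLattice w) :
    weightCoord w j x = (x : Fin (n + 1) → ℤ) j := rfl

lemma weightCoord_iota {Δ : Set (RatExt M)} {p : Fin (n + 1) → M} {w : Fin (n + 1) → ℕ}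
    {l : Fin (n + 1) → Module.Dual ℤ M} (hΔ : IsReflexivePair n Δ)
    (hp : IsSimplex Δ (fun i => toRat (p i))) (hw : IsWeights p w) (hl : IsDualVertices Δ p l)
    (j : Fin (n + 1)) (m : M) : weightCoord w j (iota hΔ hp hw hl m) = l j m := rfl

/-- The relation between the coordinate functions is the defining equation of `M(w)`, and
coordinates separate points. -/
lemma dualSystem_weightSimplex {Δ : Set (RatExt M)} {p : Fin (n + 1) → M} {w : Fin (n + 1) → ℕ}
    {l : Fin (n + 1) → Module.Dual ℤ M} (hΔ : IsReflexivePair n Δ)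
    (hp : IsSimplex Δ (fun i => toRat (p i))) (hw : IsWeights p w) (hl : IsDualVertices Δ p l) :
    DualSystem w (fun i => toRat (iota hΔ hp hw hl (p i)))
      (fun j => dualToRat (weightCoord w j)) where
  pos := hw.1
  sum_smul := by
    have := congrArg (fun x => toRat (iota hΔ hp hw hl x)) hw.2.2
    simpa [Nat.cast_smul_eq_nsmul] using this
  sum_smul_dual := by
    refine dual_ext_toRat fun x => ?_
    have h : ∑ j, (w j : ℤ) * (x : Fin (n + 1) → ℤ) j = 0 := x.2
    simp only [LinearMap.sum_apply, LinearMap.smul_apply, dualToRat_toRat, weightCoord_apply,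
      smul_eq_mul, LinearMap.zero_apply]
    exact_mod_cast h
  apply_of_ne i j hij := by
    rw [dualToRat_toRat, weightCoord_iota, hl.2 i j hij]
    norm_num
  separating x hx := by
    obtain ⟨q, m, hq, rfl⟩ := exists_smul_toRat_eq x
    have : m = 0 := by
      ext j
      have := hx j
      simpa [dualToRat_toRat, hq.ne'] using this
    simp [this]

lemma isReflexivePair_weightSimplex {Δ : Set (RatExt M)} {p : Fin (n + 1) → M}
    {w : Fin (n + 1) → ℕ} {l : Fin (n + 1) → Module.Dual ℤ M} (hΔ : IsReflexivePair n Δ)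
    (hp : IsSimplex Δ (fun i => toRat (p i))) (hw : IsWeights p w) (hl : IsDualVertices Δ p l) :
    IsReflexivePair n (weightSimplex hΔ hp hw hl) :=
  (dualSystem_weightSimplex hΔ hp hw hl).isReflexivePair

lemma image_baseChange_convexHull {M' : Type v} [AddCommGroup M'] (φ : M →ₗ[ℤ] M')
    (p : Fin (n + 1) → M) :
    φ.baseChange ℚ '' convexHull ℚ (Set.range fun i => toRat (p i)) =
      convexHull ℚ (Set.range fun i => toRat (φ (p i))) := by
  rw [LinearMap.image_convexHull, ← Set.range_comp]
  congr 2

lemma isFiniteMorphism_iota {Δ : Set (RatExt M)} {p : Fin (n + 1) → M}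
    {w : Fin (n + 1) → ℕ} {l : Fin (n + 1) → Module.Dual ℤ M} (hΔ : IsReflexivePair n Δ)
    (hp : IsSimplex Δ (fun i => toRat (p i))) (hw : IsWeights p w) (hl : IsDualVertices Δ p l) :
    IsFiniteMorphism n Δ (weightSimplex hΔ hp hw hl) (iota hΔ hp hw hl) where
  source := hΔ
  target := isReflexivePair_weightSimplex hΔ hp hw hl
  image_eq := by
    refine (congrArg (Set.image _) hp.2).trans ?_
    exact image_baseChange_convexHull _ p

lemma span_eq_top_of_isInteriorPoint {V : Type u} [AddCommGroup V] [Module ℚ V] {P : Set V}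
    (h : IsInteriorPoint P 0) : Submodule.span ℚ P = ⊤ := by
  refine eq_top_iff.2 fun v _ => ?_
  obtain ⟨ε, hε, hv⟩ := h v
  have h1 := Submodule.subset_span (R := ℚ) (hv ε hε.le le_rfl)
  rw [zero_add] at h1
  have := Submodule.smul_mem _ ε⁻¹ h1
  rwa [inv_smul_smul₀ hε.ne'] at this

/-- The image contains `Δ'`, which spans because `0` is interior, and the dimensions agree. -/
lemma bijective_baseChange_of_isFiniteMorphism {M' : Type v} [AddCommGroup M']
    {Δ : Set (RatExt M)} {Δ' : Set (RatExt M')} {ψ : M →ₗ[ℤ] M'}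
    (h : IsFiniteMorphism n Δ Δ' ψ) : Function.Bijective (ψ.baseChange ℚ) := by
  have := finiteDimensional_of_isReflexivePair h.source
  have := finiteDimensional_of_isReflexivePair h.target
  have hsurj : Function.Surjective (ψ.baseChange ℚ) := by
    rw [← LinearMap.range_eq_top, eq_top_iff,
      ← span_eq_top_of_isInteriorPoint h.target.zero_interior, Submodule.span_le, ← h.image_eq]
    rintro _ ⟨x, -, rfl⟩
    exact ⟨x, rfl⟩
  refine ⟨?_, hsurj⟩
  refine (LinearMap.injective_iff_surjective_of_finrank_eq_finrank ?_).2 hsurj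
  rw [finrank_eq_of_isReflexivePair h.source, finrank_eq_of_isReflexivePair h.target]

lemma isMaximalReflexivePair_weightSimplex {Δ : Set (RatExt M)} {p : Fin (n + 1) → M}
    {w : Fin (n + 1) → ℕ} {l : Fin (n + 1) → Module.Dual ℤ M} (hΔ : IsReflexivePair n Δ)
    (hp : IsSimplex Δ (fun i => toRat (p i))) (hw : IsWeights p w) (hl : IsDualVertices Δ p l) :
    IsMaximalReflexivePair.{0, v} n (weightSimplex hΔ hp hw hl) := by
  have hS := dualSystem_weightSimplex hΔ hp hw hl
  have hR := isReflexivePair_weightSimplex hΔ hp hw hl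
  refine ⟨⟨hR, hR, by simp⟩, fun M' _ Δ' ψ hψ => ?_⟩
  have hbij := bijective_baseChange_of_isFiniteMorphism hψ
  have hfree := hR.free
  set q : Fin (n + 1) → weightLattice w := fun i => iota hΔ hp hw hl (p i)
  have hp' : IsSimplex Δ' (fun i => toRat (ψ (q i))) := by
    refine ⟨?_, ?_⟩
    · have := hS.affineIndependent.map' (ψ.baseChange ℚ).toAffineMap hbij.1
      convert this using 1
      funext i
      exact (baseChange_toRat ψ (q i)).symm
    · rw [← hψ.image_eq, weightSimplex, image_baseChange_convexHull]
  have hqw : ∑ i, w i • q i = 0 := by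
    have := congrArg (iota hΔ hp hw hl) hw.2.2
    simpa using this
  -- Equal weights mean that `iota` for `Δ'` lands in the same lattice `M(w)`.
  have hw' : IsWeights (fun i => ψ (q i)) w := by
    refine ⟨hw.1, hw.2.1, ?_⟩
    have := congrArg ψ hqw
    simpa using this
  obtain ⟨l', hl', -⟩ := existsUnique_isDualVertices hψ.target hp'
  -- Both functionals are `-1` at the vertices `q i`, `i ≠ j`, which determines them.
  have hcoord : ∀ j, l' j ∘ₗ ψ = weightCoord w j := by
    intro j
    refine dualToRat_injective (hS.eq_of_apply_of_ne (j := j) fun i hij => ?_)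
    rw [dualToRat_toRat, hS.apply_of_ne i j hij, LinearMap.comp_apply, hl'.2 i j hij]
    norm_num
  have hcomp : LinearMap.id = iota hψ.target hp' hw' hl' ∘ₗ ψ := by
    refine LinearMap.ext fun x => Subtype.ext (funext fun j => ?_)
    exact (congrArg (fun f => f x) (hcoord j)).symm
  refine ⟨iota hψ.target hp' hw' hl', ⟨⟨hψ.target, hR, ?_⟩, hcomp⟩, fun φ hφ => ?_⟩
  · refine (congrArg (Set.image _) hψ.image_eq.symm).trans ?_
    rw [← Set.image_comp, ← LinearMap.coe_comp, ← LinearMap.baseChange_comp, ← hcomp]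
    simp
  -- Two factorizations agree after composition with `ψ`, which is onto rationally, and `M(w)`
  -- embeds in its rational extension.
  · refine LinearMap.ext fun m => toRat_injective ?_
    obtain ⟨x, hx⟩ := hbij.2 (toRat m)
    rw [← baseChange_toRat, ← baseChange_toRat, ← hx, ← LinearMap.comp_apply,
      ← LinearMap.comp_apply, ← LinearMap.baseChange_comp, ← LinearMap.baseChange_comp, ← hφ.2,
      ← hcomp]

end WeightSimplex

/-! ### Veronese subrings and `Proj` -/

section Veronese

open AlgebraicGeometry CategoryTheory HomogeneousLocalization

variable {S A : Type u} [CommRing S] [CommRing A] {σ τ : Type*} [SetLike σ S]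
  [AddSubgroupClass σ S] [SetLike τ A] [AddSubgroupClass τ A]
  (𝒮 : ℕ → σ) (𝒜 : ℕ → τ) [GradedRing 𝒮] [GradedRing 𝒜]

/-- `f` identifies the graded ring `𝒮` with the `d`-th Veronese subring of `𝒜`. -/
structure IsVeronese (d : ℕ) (f : S →+* A) : Prop where
  pos : 0 < d
  injective : Function.Injective f
  map_mem : ∀ {k s}, s ∈ 𝒮 k → f s ∈ 𝒜 (k * d)
  exists_of_mem : ∀ {k a}, a ∈ 𝒜 (k * d) → ∃ s ∈ 𝒮 k, f s = a

namespace IsVeronese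

variable {𝒮 𝒜} {d : ℕ} {f : S →+* A} (h : IsVeronese 𝒮 𝒜 d f)
include h

omit h in
lemma powers_le_comap (s : S) : Submonoid.powers s ≤ (Submonoid.powers (f s)).comap f := by
  rw [← Submonoid.map_le_iff_le_comap, Submonoid.map_powers]

/-- The function underlying the map `S_{(s)} → A_{(f s)}` of homogeneous localizations. -/
def awayFun (s : S) : Away 𝒮 s → Away 𝒜 (f s) :=
  Quotient.map'
    (fun x => ⟨x.1 * d, ⟨_, h.map_mem x.2.2⟩, ⟨_, h.map_mem x.3.2⟩, powers_le_comap s x.4⟩)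
    fun x y (e : x.embedding = y.embedding) => by
      apply_fun IsLocalization.map (Localization.Away (f s)) f (powers_le_comap s) at e
      simp_rw [NumDenSameDeg.embedding, Localization.mk_eq_mk',
        IsLocalization.map_mk', ← Localization.mk_eq_mk'] at e
      exact e

omit [AddSubgroupClass σ S] [AddSubgroupClass τ A] [GradedRing 𝒮] [GradedRing 𝒜] in
lemma val_awayFun (s : S) (x : Away 𝒮 s) :
    (h.awayFun s x).val =
      IsLocalization.map (Localization.Away (f s)) f (powers_le_comap s) x.val := by
  obtain ⟨x, rfl⟩ := mk_surjective x
  rw [val_mk, Localization.mk_eq_mk', IsLocalization.map_mk', ← Localization.mk_eq_mk']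
  rfl

/-- The map `S_{(s)} → A_{(f s)}` of homogeneous localizations. -/
def awayHom (s : S) : Away 𝒮 s →+* Away 𝒜 (f s) where
  toFun := h.awayFun s
  map_one' := by ext; simp [val_awayFun]
  map_zero' := by ext; simp [val_awayFun]
  map_add' x y := by ext; simp [val_awayFun]
  map_mul' x y := by ext; simp [val_awayFun]

lemma val_awayHom (s : S) (x : Away 𝒮 s) :
    (h.awayHom s x).val =
      IsLocalization.map (Localization.Away (f s)) f (powers_le_comap s) x.val :=
  h.val_awayFun s x

lemma awayHom_mk {s : S} {k : ℕ} (hs : s ∈ 𝒮 k) (m : ℕ) (a : S) (ha : a ∈ 𝒮 (m • k)) :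
    h.awayHom s (Away.mk 𝒮 hs m a ha) = Away.mk 𝒜 (h.map_mem hs) m (f a)
      (by have := h.map_mem ha; rwa [smul_mul_assoc] at this) := by
  ext
  rw [val_awayHom, Away.val_mk, Away.val_mk, Localization.mk_eq_mk', IsLocalization.map_mk',
    Localization.mk_eq_mk']
  congr 1
  simp

/-- Localization preserves injectivity. For surjectivity, a numerator over a power of `f s` has
degree divisible by `d`, hence comes from `𝒮`. -/
lemma bijective_awayHom {s : S} {k : ℕ} (hs : s ∈ 𝒮 k) : Function.Bijective (h.awayHom s) := by
  constructor
  · intro x y hxy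
    have := congrArg val hxy
    rw [val_awayHom, val_awayHom] at this
    have : IsLocalization ((Submonoid.powers s).map f) (Localization.Away (f s)) := by
      rw [Submonoid.map_powers]
      infer_instance
    exact val_injective _ (IsLocalization.map_injective_of_injective (Submonoid.powers s)
      (Localization.Away s) (Localization.Away (f s)) h.injective ‹_›)
  · intro y
    obtain ⟨m, a, ha, rfl⟩ := Away.mk_surjective 𝒜 (h.map_mem hs) y
    obtain ⟨b, hb, rfl⟩ := h.exists_of_mem (k := m * k) (a := a) (by
      rwa [smul_eq_mul, ← mul_assoc] at ha)
    exact ⟨Away.mk 𝒮 hs m b hb, h.awayHom_mk hs m b hb⟩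

/-- The isomorphism `S_{(s)} ≃ A_{(f s)}` of homogeneous localizations. -/
noncomputable def awayEquiv {s : S} {k : ℕ} (hs : s ∈ 𝒮 k) : Away 𝒮 s ≃+* Away 𝒜 (f s) :=
  RingEquiv.ofBijective (h.awayHom s) (h.bijective_awayHom hs)

/-- Compatibility with restriction to the overlap of two basic open sets, needed for gluing. -/
lemma awayHom_awayMap {s t x : S} {j k : ℕ} (hs : s ∈ 𝒮 j) (ht : t ∈ 𝒮 k) (hx : x = s * t)
    (y : Away 𝒮 s) :
    h.awayHom x (awayMap 𝒮 ht hx y) =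
      awayMap 𝒜 (h.map_mem ht) (show f x = f s * f t by rw [hx, map_mul]) (h.awayHom s y) := by
  obtain ⟨m, a, ha, rfl⟩ := Away.mk_surjective 𝒮 hs y
  rw [awayMap_mk, h.awayHom_mk hs, awayMap_mk, h.awayHom_mk]
  ext
  simp

omit [AddSubgroupClass σ S] [AddSubgroupClass τ A] [GradedRing 𝒮] [GradedRing 𝒜] in
lemma pos_mul {k : ℕ} (hk : 0 < k) : 0 < k * d := Nat.mul_pos hk h.pos

lemma awayMap_awayEquiv_symm {s t x : S} {j k : ℕ} (hs : s ∈ 𝒮 j) (ht : t ∈ 𝒮 k)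
    (hxk : x ∈ 𝒮 (j + k)) (hx : x = s * t) (y : Away 𝒜 (f s)) :
    awayMap 𝒮 ht hx ((h.awayEquiv hs).symm y) = (h.awayEquiv hxk).symm
      (awayMap 𝒜 (h.map_mem ht) (show f x = f s * f t by rw [hx, map_mul]) y) := by
  rw [RingEquiv.eq_symm_apply]
  change h.awayHom x _ = _
  rw [h.awayHom_awayMap hs]
  congr 1
  exact (h.awayEquiv hs).apply_symm_apply y

lemma specMap_awayMap_awayHom {s t x : S} {j k : ℕ} (hj : 0 < j) (hs : s ∈ 𝒮 j) (ht : t ∈ 𝒮 k)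
    (hx : x = s * t) :
    Spec.map (CommRingCat.ofHom (awayMap 𝒜 (h.map_mem ht)
        (show f x = f s * f t by rw [hx, map_mul]))) ≫
      Spec.map (CommRingCat.ofHom (h.awayHom s)) ≫ Proj.awayι 𝒮 s hs hj =
    Spec.map (CommRingCat.ofHom (h.awayHom x)) ≫
      Proj.awayι 𝒮 x (hx ▸ SetLike.mul_mem_graded hs ht) (hj.trans_le (Nat.le_add_right j k)) := by
  rw [← Proj.SpecMap_awayMap_awayι 𝒮 hs hj ht hx, ← Category.assoc, ← Category.assoc,
    ← Spec.map_comp, ← Spec.map_comp, ← CommRingCat.ofHom_comp, ← CommRingCat.ofHom_comp]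
  have e : (awayMap 𝒜 (h.map_mem ht) (show f x = f s * f t by rw [hx, map_mul])).comp
      (h.awayHom s) = (h.awayHom x).comp (awayMap 𝒮 ht hx) :=
    RingHom.ext fun y => (h.awayHom_awayMap hs ht hx y).symm
  rw [e]

lemma specMap_awayMap_awayEquiv_symm {s t x : S} {j k : ℕ} (hj : 0 < j) (hs : s ∈ 𝒮 j)
    (ht : t ∈ 𝒮 k) (hxk : x ∈ 𝒮 (j + k)) (hx : x = s * t) :
    Spec.map (CommRingCat.ofHom (awayMap 𝒮 ht hx)) ≫
      Spec.map (CommRingCat.ofHom (h.awayEquiv hs).symm.toRingHom) ≫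
        Proj.awayι 𝒜 (f s) (h.map_mem hs) (h.pos_mul hj) =
    Spec.map (CommRingCat.ofHom (h.awayEquiv hxk).symm.toRingHom) ≫
      Proj.awayι 𝒜 (f x) (h.map_mem hxk) (h.pos_mul (hj.trans_le (Nat.le_add_right j k))) := by
  have hfx : f x = f s * f t := by rw [hx, map_mul]
  have e : Proj.awayι 𝒜 (f x) (h.map_mem hxk) (h.pos_mul (hj.trans_le (Nat.le_add_right j k))) =
      Spec.map (CommRingCat.ofHom (awayMap 𝒜 (h.map_mem ht) hfx)) ≫
        Proj.awayι 𝒜 (f s) (h.map_mem hs) (h.pos_mul hj) :=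
    (Proj.SpecMap_awayMap_awayι 𝒜 (h.map_mem hs) (h.pos_mul hj) (h.map_mem ht) hfx).symm
  rw [e, ← Category.assoc, ← Category.assoc,
    ← Spec.map_comp, ← Spec.map_comp, ← CommRingCat.ofHom_comp, ← CommRingCat.ofHom_comp]
  have e' : (awayMap 𝒮 ht hx).comp (h.awayEquiv hs).symm.toRingHom =
      (h.awayEquiv hxk).symm.toRingHom.comp (awayMap 𝒜 (h.map_mem ht) hfx) :=
    RingHom.ext fun y => h.awayMap_awayEquiv_symm hs ht hxk hx y
  rw [e']

omit [AddSubgroupClass σ S] [GradedRing 𝒮] in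
-- The `d`-th power of a homogeneous element lies in the image of `f` and defines the same basic
-- open set.
lemma exists_mem_basicOpen (x : Proj 𝒜) :
    ∃ i : Σ i : PNat, 𝒮 i, x ∈ Proj.basicOpen 𝒜 (f i.2) := by
  obtain ⟨k, a, hk, ha, hx⟩ : ∃ (k : ℕ) (a : A), 0 < k ∧ a ∈ 𝒜 k ∧ x ∈ Proj.basicOpen 𝒜 a := by
    obtain ⟨i, y, hy⟩ := (Proj.affineOpenCover 𝒜).openCover.exists_eq x
    have hx : x ∈ ((Proj.affineOpenCover 𝒜).openCover.f i).opensRange := ⟨y, hy⟩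
    exact ⟨_, _, i.1.2, i.2.2, (Proj.opensRange_awayι 𝒜 _ i.2.2 i.1.2).le hx⟩
  obtain ⟨s, hs, hsa⟩ := h.exists_of_mem (k := k) (a := a ^ d) (by
    have := SetLike.pow_mem_graded d ha
    rwa [smul_eq_mul, mul_comm] at this)
  refine ⟨⟨⟨k, hk⟩, ⟨s, hs⟩⟩, ?_⟩
  change x ∈ Proj.basicOpen 𝒜 (f s)
  rwa [hsa, Proj.basicOpen_pow _ _ _ h.pos]

/-- The cover of `Proj 𝒜` by the basic open sets of elements of the Veronese subring. -/
noncomputable def affineOpenCover : (Proj 𝒜).AffineOpenCover where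
  I₀ := Σ i : PNat, 𝒮 i
  X i := .of (Away 𝒜 (f i.2))
  f i := Proj.awayι 𝒜 (f i.2) (h.map_mem i.2.2) (h.pos_mul i.1.2)
  idx x := (h.exists_mem_basicOpen x).choose
  covers x := by
    change x ∈ (Proj.awayι 𝒜 _ _ _).opensRange
    rw [Proj.opensRange_awayι]
    exact (h.exists_mem_basicOpen x).choose_spec

lemma projHom_compat {s t : S} {j k : ℕ} (hj : 0 < j) (hk : 0 < k) (hs : s ∈ 𝒮 j)
    (ht : t ∈ 𝒮 k) :
    Limits.pullback.fst (Proj.awayι 𝒜 (f s) (h.map_mem hs) (h.pos_mul hj))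
        (Proj.awayι 𝒜 (f t) (h.map_mem ht) (h.pos_mul hk)) ≫
      Spec.map (CommRingCat.ofHom (h.awayHom s)) ≫ Proj.awayι 𝒮 s hs hj =
    Limits.pullback.snd (Proj.awayι 𝒜 (f s) (h.map_mem hs) (h.pos_mul hj))
        (Proj.awayι 𝒜 (f t) (h.map_mem ht) (h.pos_mul hk)) ≫
      Spec.map (CommRingCat.ofHom (h.awayHom t)) ≫ Proj.awayι 𝒮 t ht hk := by
  have hx : f (s * t) = f s * f t := map_mul f _ _
  rw [← Proj.pullbackAwayιIso_hom_SpecMap_awayMap_left 𝒜 (h.map_mem hs) (h.pos_mul hj)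
    (h.map_mem ht) (h.pos_mul hk) hx, ← Proj.pullbackAwayιIso_hom_SpecMap_awayMap_right 𝒜
    (h.map_mem hs) (h.pos_mul hj) (h.map_mem ht) (h.pos_mul hk) hx, Category.assoc, Category.assoc,
    h.specMap_awayMap_awayHom hj hs ht rfl, h.specMap_awayMap_awayHom hk ht hs (mul_comm s t)]
  rfl

lemma projInv_compat {s t : S} {j k : ℕ} (hj : 0 < j) (hk : 0 < k) (hs : s ∈ 𝒮 j)
    (ht : t ∈ 𝒮 k) :
    Limits.pullback.fst (Proj.awayι 𝒮 s hs hj) (Proj.awayι 𝒮 t ht hk) ≫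
      Spec.map (CommRingCat.ofHom (h.awayEquiv hs).symm.toRingHom) ≫
        Proj.awayι 𝒜 (f s) (h.map_mem hs) (h.pos_mul hj) =
    Limits.pullback.snd (Proj.awayι 𝒮 s hs hj) (Proj.awayι 𝒮 t ht hk) ≫
      Spec.map (CommRingCat.ofHom (h.awayEquiv ht).symm.toRingHom) ≫
        Proj.awayι 𝒜 (f t) (h.map_mem ht) (h.pos_mul hk) := by
  have hm : s * t ∈ 𝒮 (j + k) := SetLike.mul_mem_graded hs ht
  rw [← Proj.pullbackAwayιIso_hom_SpecMap_awayMap_left 𝒮 hs hj ht hk rfl,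
    ← Proj.pullbackAwayιIso_hom_SpecMap_awayMap_right 𝒮 hs hj ht hk rfl,
    Category.assoc, Category.assoc, h.specMap_awayMap_awayEquiv_symm hj hs ht hm rfl,
    h.specMap_awayMap_awayEquiv_symm hk ht hs (add_comm j k ▸ hm) (mul_comm s t)]
  rfl

/-- The morphism from `Proj` of a graded ring to `Proj` of a Veronese subring. -/
noncomputable def projHom : Proj 𝒜 ⟶ Proj 𝒮 :=
  h.affineOpenCover.openCover.glueMorphisms
    (fun i => Spec.map (CommRingCat.ofHom (h.awayHom i.2.1)) ≫ Proj.awayι 𝒮 i.2.1 i.2.2 i.1.2)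
    fun i j => h.projHom_compat i.1.2 j.1.2 i.2.2 j.2.2

/-- The morphism from `Proj` of a Veronese subring to `Proj` of the graded ring. -/
noncomputable def projInv : Proj 𝒮 ⟶ Proj 𝒜 :=
  (Proj.affineOpenCover 𝒮).openCover.glueMorphisms
    (fun i => Spec.map (CommRingCat.ofHom (h.awayEquiv i.2.2).symm.toRingHom) ≫
      Proj.awayι 𝒜 (f i.2.1) (h.map_mem i.2.2) (h.pos_mul i.1.2))
    fun i j => h.projInv_compat i.1.2 j.1.2 i.2.2 j.2.2

lemma awayι_projHom {s : S} {k : ℕ} (hs : s ∈ 𝒮 k) (hk : 0 < k) :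
    Proj.awayι 𝒜 (f s) (h.map_mem hs) (h.pos_mul hk) ≫ h.projHom =
      Spec.map (CommRingCat.ofHom (h.awayHom s)) ≫ Proj.awayι 𝒮 s hs hk :=
  h.affineOpenCover.openCover.ι_glueMorphisms _ _ ⟨⟨k, hk⟩, ⟨s, hs⟩⟩

lemma awayι_projInv {s : S} {k : ℕ} (hs : s ∈ 𝒮 k) (hk : 0 < k) :
    Proj.awayι 𝒮 s hs hk ≫ h.projInv =
      Spec.map (CommRingCat.ofHom (h.awayEquiv hs).symm.toRingHom) ≫
        Proj.awayι 𝒜 (f s) (h.map_mem hs) (h.pos_mul hk) :=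
  (Proj.affineOpenCover 𝒮).openCover.ι_glueMorphisms _ _ ⟨⟨k, hk⟩, ⟨s, hs⟩⟩

lemma awayι_projHom_assoc {s : S} {k : ℕ} (hs : s ∈ 𝒮 k) (hk : 0 < k) {X : Scheme.{u}}
    (g : Proj 𝒮 ⟶ X) :
    Proj.awayι 𝒜 (f s) (h.map_mem hs) (h.pos_mul hk) ≫ h.projHom ≫ g =
      Spec.map (CommRingCat.ofHom (h.awayHom s)) ≫ Proj.awayι 𝒮 s hs hk ≫ g := by
  rw [← Category.assoc, h.awayι_projHom hs hk, Category.assoc]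

lemma awayι_projInv_assoc {s : S} {k : ℕ} (hs : s ∈ 𝒮 k) (hk : 0 < k) {X : Scheme.{u}}
    (g : Proj 𝒜 ⟶ X) :
    Proj.awayι 𝒮 s hs hk ≫ h.projInv ≫ g =
      Spec.map (CommRingCat.ofHom (h.awayEquiv hs).symm.toRingHom) ≫
        Proj.awayι 𝒜 (f s) (h.map_mem hs) (h.pos_mul hk) ≫ g := by
  rw [← Category.assoc, h.awayι_projInv hs hk, Category.assoc]

lemma proj_hom_ext {X : Scheme.{u}} {g g' : Proj 𝒜 ⟶ X}
    (hg : ∀ (s : S) (k : ℕ) (hs : s ∈ 𝒮 k) (hk : 0 < k),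
      Proj.awayι 𝒜 (f s) (h.map_mem hs) (h.pos_mul hk) ≫ g =
        Proj.awayι 𝒜 (f s) (h.map_mem hs) (h.pos_mul hk) ≫ g') : g = g' :=
  h.affineOpenCover.openCover.hom_ext _ _ fun i => hg i.2.1 i.1 i.2.2 i.1.2

omit h in
lemma hom_ext_awayι {X : Scheme.{u}} {g g' : Proj 𝒮 ⟶ X}
    (hg : ∀ (s : S) (k : ℕ) (hs : s ∈ 𝒮 k) (hk : 0 < k),
      Proj.awayι 𝒮 s hs hk ≫ g = Proj.awayι 𝒮 s hs hk ≫ g') : g = g' :=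
  (Proj.affineOpenCover 𝒮).openCover.hom_ext _ _ fun i => hg i.2.1 i.1 i.2.2 i.1.2

/-- `Proj` of a graded ring is isomorphic to `Proj` of a Veronese subring. -/
noncomputable def projIso : Proj 𝒜 ≅ Proj 𝒮 where
  hom := h.projHom
  inv := h.projInv
  hom_inv_id := by
    refine h.proj_hom_ext fun s k hs hk => ?_
    rw [h.awayι_projHom_assoc hs hk, h.awayι_projInv hs hk, ← Category.assoc, ← Spec.map_comp,
      ← CommRingCat.ofHom_comp, Category.comp_id]
    have : (h.awayHom s).comp (h.awayEquiv hs).symm.toRingHom = RingHom.id _ :=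
      RingHom.ext (h.awayEquiv hs).apply_symm_apply
    rw [this, CommRingCat.ofHom_id, Spec.map_id, Category.id_comp]
  inv_hom_id := by
    refine hom_ext_awayι fun s k hs hk => ?_
    rw [h.awayι_projInv_assoc hs hk, h.awayι_projHom hs hk, ← Category.assoc, ← Spec.map_comp,
      ← CommRingCat.ofHom_comp, Category.comp_id]
    have : (h.awayEquiv hs).symm.toRingHom.comp (h.awayHom s) = RingHom.id _ :=
      RingHom.ext (h.awayEquiv hs).symm_apply_apply
    rw [this, CommRingCat.ofHom_id, Spec.map_id, Category.id_comp]

end IsVeronese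

/-- `Proj` of a graded algebra and of a Veronese subalgebra are isomorphic over `ℂ`. -/
theorem nonempty_projOver_iso {S A : Type} [CommRing S] [CommRing A] [Algebra ℂ S] [Algebra ℂ A]
    {𝒮 : ℕ → Submodule ℂ S} {𝒜 : ℕ → Submodule ℂ A} [GradedAlgebra 𝒮] [GradedAlgebra 𝒜] {d : ℕ}
    (f : S →ₐ[ℂ] A) (h : IsVeronese 𝒮 𝒜 d (f : S →+* A)) :
    Nonempty (projOver 𝒮 ≅ projOver 𝒜) := by
  refine ⟨(Over.isoMk h.projIso ?_).symm⟩
  change h.projHom ≫ Proj.toSpecZero 𝒮 ≫ Spec.map (CommRingCat.ofHom (algebraMap ℂ (𝒮 0))) =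
      Proj.toSpecZero 𝒜 ≫ Spec.map (CommRingCat.ofHom (algebraMap ℂ (𝒜 0)))
  refine h.proj_hom_ext fun s k hs hk => ?_
  rw [h.awayι_projHom_assoc hs hk, Proj.awayι_toSpecZero_assoc, Proj.awayι_toSpecZero_assoc,
    ← Spec.map_comp, ← Spec.map_comp, ← Spec.map_comp, ← CommRingCat.ofHom_comp,
    ← CommRingCat.ofHom_comp, ← CommRingCat.ofHom_comp]
  -- On each chart, both structure maps send a constant `c` to the fraction `c / 1`.
  congr 2
  refine RingHom.ext fun c => ?_
  ext
  simp only [RingHom.comp_apply, h.val_awayHom]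
  change IsLocalization.map _ _ _ (Localization.mk (algebraMap ℂ S c) 1) =
    Localization.mk (algebraMap ℂ A c) 1
  rw [Localization.mk_one_eq_algebraMap, IsLocalization.map_eq, Localization.mk_one_eq_algebraMap]
  congr 1
  exact f.commutes c

end Veronese

/-! ### The coordinate ring of `Δ(w)` -/

section CoordinateRing

lemma map_supported_mapDomainAlgHom {P Q : Type*} [AddCommMonoid P] [AddCommMonoid Q] (θ : P →+ Q)
    (s : Set P) :
    (AddMonoidAlgebra.supported ℂ ℂ s).map (AddMonoidAlgebra.mapDomainAlgHom ℂ ℂ θ).toLinearMap =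
      AddMonoidAlgebra.supported ℂ ℂ (θ '' s) := by
  rw [AddMonoidAlgebra.supported_eq_span_single, AddMonoidAlgebra.supported_eq_span_single,
    Submodule.map_span, Set.image_image, Set.image_image]
  simp only [AlgHom.toLinearMap_apply, AddMonoidAlgebra.mapDomainAlgHom_apply,
    AddMonoidAlgebra.mapDomain_single]

/-- Graded pieces are spanned by monomials, so the Veronese property can be checked on exponents. -/
lemma isVeronese_mapDomainAlgHom {P Q : Type u} [AddCommMonoid P] [AddCommMonoid Q] {θ : P →+ Q}
    (hθ : Function.Injective θ) {degP : P → ℕ} {degQ : Q → ℕ} {d : ℕ} (hd : 0 < d)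
    (himage : ∀ k, θ '' {a | degP a = k} = {b | degQ b = k * d})
    {𝒮 : ℕ → Submodule ℂ (AddMonoidAlgebra ℂ P)} {𝒜 : ℕ → Submodule ℂ (AddMonoidAlgebra ℂ Q)}
    (h𝒮 : ∀ k, 𝒮 k = AddMonoidAlgebra.supported ℂ ℂ {a | degP a = k})
    (h𝒜 : ∀ k, 𝒜 k = AddMonoidAlgebra.supported ℂ ℂ {b | degQ b = k}) :
    IsVeronese 𝒮 𝒜 d
      (AddMonoidAlgebra.mapDomainAlgHom ℂ ℂ θ : AddMonoidAlgebra ℂ P →+* AddMonoidAlgebra ℂ Q) := by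
  have key : ∀ k, 𝒜 (k * d) = (𝒮 k).map (AddMonoidAlgebra.mapDomainAlgHom ℂ ℂ θ).toLinearMap :=
    fun k => by rw [h𝒮, map_supported_mapDomainAlgHom, himage, h𝒜]
  refine ⟨hd, AddMonoidAlgebra.mapDomain_injective hθ, fun {k s} hs => ?_, fun {k a} ha => ?_⟩
  · rw [key]
    exact ⟨s, hs, rfl⟩
  · rwa [key] at ha

variable {n : ℕ} {w : Fin (n + 1) → ℕ} {P : Fin (n + 1) → RatExt (weightLattice w)}

lemma mem_coneMonoid_iff (h : DualSystem w P (fun j => dualToRat (weightCoord w j)))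
    (a : ℕ × weightLattice w) :
    a ∈ coneMonoid (convexHull ℚ (Set.range P)) (convex_convexHull ℚ _) ↔
      ∀ j, 0 ≤ (a.2 : Fin (n + 1) → ℤ) j + a.1 := by
  change (a = 0 ∨ 0 < a.1 ∧ (a.1 : ℚ)⁻¹ • toRat a.2 ∈ convexHull ℚ (Set.range P)) ↔ _
  obtain ⟨m, x⟩ := a
  rcases Nat.eq_zero_or_pos m with rfl | hm
  · simp only [lt_irrefl, false_and, or_false, Nat.cast_zero, add_zero]
    refine ⟨fun hx j => ?_, fun hx => ?_⟩
    · rw [(Prod.mk.inj hx).2]; simp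
    -- At height `0` only the apex may survive: nonnegative coordinates with vanishing positively
    -- weighted sum are all zero.
    · have hrel : ∑ i, (w i : ℤ) * (x : Fin (n + 1) → ℤ) i = 0 := x.2
      have hzero : x = 0 := by
        ext j
        have := (Finset.sum_eq_zero_iff_of_nonneg fun i _ =>
          mul_nonneg (Nat.cast_nonneg (w i)) (hx i)).1 hrel j (Finset.mem_univ j)
        simpa [(h.pos j).ne'] using this
      rw [hzero]; rfl
  · have hm' : (0 : ℚ) < m := by exact_mod_cast hm
    have hne : (m, x) ≠ 0 := fun h0 => hm.ne' (Prod.mk.inj h0).1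
    rw [h.convexHull_eq]
    simp only [hne, hm, true_and, false_or, Set.mem_ofPred_eq, map_smul, dualToRat_toRat,
      weightCoord_apply, smul_eq_mul]
    refine forall_congr' fun j => ?_
    rw [inv_mul_eq_div, le_div_iff₀ hm']
    constructor
    · intro hj
      have : (0 : ℚ) ≤ (x : Fin (n + 1) → ℤ) j + m := by linarith
      exact_mod_cast this
    · intro hj
      have : (0 : ℚ) ≤ (x : Fin (n + 1) → ℤ) j + m := by exact_mod_cast hj
      linarith

/-- The homomorphism `(m₀, x) ↦ (x_j + m₀)_j` from the lattice points of the cone over `Δ(w)` to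
the exponents of monomials. -/
noncomputable def coneExponent (h : DualSystem w P (fun j => dualToRat (weightCoord w j))) :
    coneMonoid (convexHull ℚ (Set.range P)) (convex_convexHull ℚ _) →+ (Fin (n + 1) →₀ ℕ) where
  toFun a := Finsupp.equivFunOnFinite.symm
    fun j => ((a.1.2 : Fin (n + 1) → ℤ) j + a.1.1).toNat
  map_zero' := by
    ext j
    simp
  map_add' a b := by
    ext j
    have ha := (mem_coneMonoid_iff h a.1).1 a.2 j
    have hb := (mem_coneMonoid_iff h b.1).1 b.2 j
    simp only [AddSubmonoid.coe_add, Prod.fst_add, Prod.snd_add, Submodule.coe_add, Pi.add_apply,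
      Finsupp.equivFunOnFinite_symm_apply_apply, Finsupp.add_apply]
    rw [← Int.toNat_add ha hb]
    congr 1
    push_cast
    ring

lemma coe_coneExponent (h : DualSystem w P (fun j => dualToRat (weightCoord w j)))
    (a : coneMonoid (convexHull ℚ (Set.range P)) (convex_convexHull ℚ _)) (j : Fin (n + 1)) :
    (coneExponent h a j : ℤ) = (a.1.2 : Fin (n + 1) → ℤ) j + a.1.1 :=
  Int.toNat_of_nonneg ((mem_coneMonoid_iff h a.1).1 a.2 j)

/-- The part `∑ w i * x i` vanishes on `M(w)`; this is why the Veronese degree is `∑ w i`. -/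
lemma weight_coneExponent (h : DualSystem w P (fun j => dualToRat (weightCoord w j)))
    (a : coneMonoid (convexHull ℚ (Set.range P)) (convex_convexHull ℚ _)) :
    Finsupp.weight w (coneExponent h a) = a.1.1 * ∑ i, w i := by
  have hrel : ∑ i, (w i : ℤ) * (a.1.2 : Fin (n + 1) → ℤ) i = 0 := a.1.2.2
  rw [Finsupp.weight_eq_sum]
  zify
  simp only [smul_eq_mul, Nat.cast_mul, coe_coneExponent, add_mul, Finset.sum_add_distrib,
    ← Finset.mul_sum]
  simp only [mul_comm] at hrel ⊢
  rw [hrel, zero_add]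

lemma sum_weights_pos (h : DualSystem w P (fun j => dualToRat (weightCoord w j))) :
    0 < ∑ i, w i := Finset.sum_pos (fun i _ => h.pos i) Finset.univ_nonempty

lemma coneExponent_injective (h : DualSystem w P (fun j => dualToRat (weightCoord w j))) :
    Function.Injective (coneExponent h) := by
  intro a b hab
  have h1 : a.1.1 = b.1.1 := by
    have := congrArg (Finsupp.weight w) hab
    rw [weight_coneExponent, weight_coneExponent] at this
    exact Nat.eq_of_mul_eq_mul_right (sum_weights_pos h) this
  refine Subtype.ext (Prod.ext h1 (Subtype.ext (funext fun j => ?_)))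
  have := congrArg (fun e => (e j : ℤ)) hab
  simp only [coe_coneExponent, h1] at this
  linarith

lemma image_coneExponent (h : DualSystem w P (fun j => dualToRat (weightCoord w j))) (k : ℕ) :
    coneExponent h '' {a | coneDegree _ _ a = k} = {e | Finsupp.weight w e = k * ∑ i, w i} := by
  ext e
  constructor
  · rintro ⟨a, rfl, rfl⟩
    exact weight_coneExponent h a
  · intro he
    have he' : ∑ i, (w i : ℤ) * ((e i : ℤ) - k) = 0 := by
      have : ∑ i, (e i : ℤ) * w i = k * ∑ i, (w i : ℤ) := by
        rw [Set.mem_ofPred_eq, Finsupp.weight_eq_sum] at he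
        exact_mod_cast he
      simp only [mul_sub, Finset.sum_sub_distrib, ← Finset.sum_mul]
      simp only [mul_comm] at this ⊢
      rw [this, sub_self]
    let x : weightLattice w := ⟨fun i => (e i : ℤ) - k, he'⟩
    have hx : (k, x) ∈ coneMonoid (convexHull ℚ (Set.range P)) (convex_convexHull ℚ _) :=
      (mem_coneMonoid_iff h _).2 fun j => by simp [x]
    refine ⟨⟨(k, x), hx⟩, rfl, ?_⟩
    ext j
    zify
    rw [coe_coneExponent]
    simp [x]

open CategoryTheory in
theorem nonempty_toricVariety_iso
    (h : DualSystem w P (fun j => dualToRat (weightCoord w j))) :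
    Nonempty (toricVariety (convexHull ℚ (Set.range P)) (convex_convexHull ℚ _) ≅
      weightedProjectiveSpace w) := by
  let := MvPolynomial.weightedGradedAlgebra ℂ w
  exact nonempty_projOver_iso _ (isVeronese_mapDomainAlgHom (coneExponent_injective h)
    (sum_weights_pos h) (image_coneExponent h) (fun _ => rfl)
    (MvPolynomial.weightedHomogeneousSubmodule_eq_finsupp_supported ℂ w))

end CoordinateRing

end ReflexiveSimplex

theorem mainTheorem12 {M : Type u} [AddCommGroup M] {n : ℕ}
    (Δ : Set (ReflexiveSimplex.RatExt M)) (p : Fin (n + 1) → M)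
    (hΔ : ReflexiveSimplex.IsReflexivePair n Δ)
    (hp : ReflexiveSimplex.IsSimplex Δ (fun i => ReflexiveSimplex.toRat (p i))) :
    (∃! w : Fin (n + 1) → ℕ, ReflexiveSimplex.IsWeights p w) ∧
    (∃! l : Fin (n + 1) → Module.Dual ℤ M, ReflexiveSimplex.IsDualVertices Δ p l) ∧
    ∀ (w : Fin (n + 1) → ℕ) (l : Fin (n + 1) → Module.Dual ℤ M)
      (hw : ReflexiveSimplex.IsWeights p w) (hl : ReflexiveSimplex.IsDualVertices Δ p l),
      ReflexiveSimplex.IsReflexivePair n (ReflexiveSimplex.weightSimplex hΔ hp hw hl) ∧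
      Nonempty (ReflexiveSimplex.toricVariety (ReflexiveSimplex.weightSimplex hΔ hp hw hl)
          (convex_convexHull ℚ _) ≅ ReflexiveSimplex.weightedProjectiveSpace w) ∧
      ReflexiveSimplex.IsFiniteMorphism n Δ (ReflexiveSimplex.weightSimplex hΔ hp hw hl)
        (ReflexiveSimplex.iota hΔ hp hw hl) ∧
      ReflexiveSimplex.IsMaximalReflexivePair.{0, v} n
        (ReflexiveSimplex.weightSimplex hΔ hp hw hl) :=
  ⟨ReflexiveSimplex.existsUnique_isWeights hΔ hp,
    ReflexiveSimplex.existsUnique_isDualVertices hΔ hp, fun _ _ hw hl =>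
    ⟨ReflexiveSimplex.isReflexivePair_weightSimplex hΔ hp hw hl,
      ReflexiveSimplex.nonempty_toricVariety_iso
        (ReflexiveSimplex.dualSystem_weightSimplex hΔ hp hw hl),
      ReflexiveSimplex.isFiniteMorphism_iota hΔ hp hw hl,
      ReflexiveSimplex.isMaximalReflexivePair_weightSimplex hΔ hp hw hl⟩⟩
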